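/- Throughout, $B(0,r)$ denotes the open Euclidean ball of radius $r$ centred at $0$ in $\mathbb R^2$. Let $0<R<R_0\le R_1$, and let $V_{per}$ be a bounded measurable real function on $B(0,R_1)$ (a bounded representative of an element of $L^\infty(B(0,R_1))$). Let $I\subset\mathbb R$ be compact. Extend $V_{per}$ by $0$ outside $B(0,R_1)$ and, for $\theta>0$, put $$\omega_V(\theta)=\sup_{x_0\in B(0,R_0)}\ \sup_{t\in B(0,\theta)}|V_{per}(x_0-t)-V_{per}(x_0)|,$$ with the convention $\omega_V(\theta)=\theta$ if $V_{per}$ is constant on $B(0,R_0)$. For $\kappa>0$ and $h>0$ put $\tilde\omega_V(h)=\omega_V(\kappa h^{2/3})$. Write $C_0^\infty(S)$ for the smooth complex-valued functions on $\mathbb R^2$ with compact support contained in $S$, and $|\nabla u|^2=|\partial_1u|^2+|\partial_2u|^2$. 1. For all sufficiently small $\kappa>0$ there are a positive function $\tilde\phi\in C^\infty(\mathbb R^2,\mathbb R)$ and constants $h_0>0$, $C>0$ such that for all $E\in I$, all $h\in(0,h_0]$ and all $u\in C_0^\infty(B(0,R_0))$, $$\int_{B(0,R_0)} e^{2\tilde\phi(x)\,\tilde\omega_V(h)^{1/2}/h^{4/3}}\left(|u(x)|^2+|h\nabla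 u(x)|^2\right)dx\le \frac{C}{\tilde\omega_V(h)^{1/2}h^{2/3}}\int_{B(0,R_0)} e^{2\tilde\phi(x)\,\tilde\omega_V(h)^{1/2}/h^{4/3}}\left|(-h^2\Delta+V_{per}(x)-E)u(x)\right|^2dx .$$ 2. For all sufficiently small $\kappa>0$ there are a positive function $\tilde\phi\in C^\infty(\mathbb R^2,\mathbb R)$ that is radial and strictly decreasing in $|x|$, and constants $h_0>0$, $C>0$, such that the same inequality holds for all $E\in I$, all $h\in(0,h_0]$ and all $u\in C_0^\infty(B(0,R_0)\setminus B(0,R/2))$. -/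

import Mathlib

open MeasureTheory
open scoped ContDiff

noncomputable section

/-- The Euclidean plane. -/
abbrev Plane : Type := EuclideanSpace ℝ (Fin 2)

/-- The extension by `0` of a potential given on the ball `B(0, R₁)`. -/
def zeroExtension (R₁ : ℝ) (V : Plane → ℝ) : Plane → ℝ :=
  Set.indicator (Metric.ball (0 : Plane) R₁) V

/-- The oscillation of `W` at scale `θ` over `B(0, R₀)`: the supremum over `x₀ ∈ B(0, R₀)` and
`t ∈ B(0, θ)` of `|W (x₀ - t) - W x₀|`. -/
def localOscillation (R₀ : ℝ) (W : Plane → ℝ) (θ : ℝ) : ℝ :=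
  ⨆ x₀ : Metric.ball (0 : Plane) R₀, ⨆ t : Metric.ball (0 : Plane) θ,
    |W ((x₀ : Plane) - (t : Plane)) - W (x₀ : Plane)|

open Classical in
/-- The modulus `ω_V` of a potential given on `B(0, R₁)` and extended by `0`, with the convention
that `ω_V` is the identity when `V` is constant on `B(0, R₀)`. -/
def modulus (R₀ R₁ : ℝ) (V : Plane → ℝ) (θ : ℝ) : ℝ :=
  if ∃ c : ℝ, ∀ x ∈ Metric.ball (0 : Plane) R₀, V x = c then θ
  else localOscillation R₀ (zeroExtension R₁ V) θ

/-- The rescaled modulus `h ↦ ω_V (κ h^{2/3})`. -/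
def scaledModulus (R₀ R₁ : ℝ) (V : Plane → ℝ) (κ h : ℝ) : ℝ :=
  modulus R₀ R₁ V (κ * h ^ (2 / 3 : ℝ))

/-- `u` is a smooth complex function on the plane with compact support contained in `S`. -/
def IsTestFunctionOn (S : Set Plane) (u : Plane → ℂ) : Prop :=
  ContDiff ℝ ∞ u ∧ HasCompactSupport u ∧ tsupport u ⊆ S

/-- `|∇u(x)|² = |∂₁u(x)|² + |∂₂u(x)|²`. -/
def gradSq (u : Plane → ℂ) (x : Plane) : ℝ :=
  ∑ i : Fin 2, ‖fderiv ℝ u x (EuclideanSpace.single i 1)‖ ^ 2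

/-- `(-h²Δ + V - E) u` at the point `x`. -/
def schrodinger (h : ℝ) (V : Plane → ℝ) (E : ℝ) (u : Plane → ℂ) (x : Plane) : ℂ :=
  -((h : ℂ) ^ 2) * Laplacian.laplacian u x + ((V x : ℂ) - (E : ℂ)) * u x

/-- The weight `e^{2 φ(x) w^{1/2} / h^{4/3}}`. -/
def weight (φ : Plane → ℝ) (w h : ℝ) (x : Plane) : ℝ :=
  Real.exp (2 * φ x * w ^ (1 / 2 : ℝ) / h ^ (4 / 3 : ℝ))

/-- `φ` is a radial function, strictly decreasing in the distance to the origin. -/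
def RadiallyDecreasing (φ : Plane → ℝ) : Prop :=
  ∃ g : ℝ → ℝ, StrictAntiOn g (Set.Ici 0) ∧ ∀ x, φ x = g ‖x‖

end

/-! Write w = ω_V(κh^{2/3}) and τ = w^{1/2}/h^{1/3}: the exponent of the weight is 2φτ/h and the
gain is hτ. The weight is φ = lψ with ψ a Gaussian and l a large constant. For v = e^{τlψ/h}u the
conjugated operator is A = -h²Δ + V - E - τ²l²|∇ψ|² plus hτl(2∇ψ·∇ + Δψ).

As V is merely bounded, A is taken with a mollification Vt at scale κh^{2/3}
(`exists_mollification_bound`). Then |V - Vt| ≤ w, and ∇Vt is O(w/h^{2/3}) = O(τ²), the size of the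
positive commutator term l²τ²v². The remainder has square w² = O(hτ³) because hτ³ = w^{3/2}; this
balance fixes the power h^{4/3}. A large l absorbs both.

Pairing Av with 2∇ψ·∇v + mv gives a divergence plus a quadratic form (`exists_divergence_identity`).
With m = Δψ the form can be negative on tangential gradients; a shifted m makes it positive in both
v and ∇v away from the centre of the Gaussian (`exists_carlemanWeight_gaussian`). The shift leaves
the undifferentiated term (Vt - E)v², which is absorbed because τ is bounded below: w is at least of
order h^{2/3}, by chaining small steps when V is not constant (`le_localOscillation_of_ne`) and by
convention otherwise.

The two claims differ only in the centre of the Gaussian. -/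

/-! ### Partial derivatives on the plane. -/

/-- The `i`-th partial derivative on the plane. -/
noncomputable def pd (i : Fin 2) (f : Plane → ℝ) (x : Plane) : ℝ :=
  fderiv ℝ f x (EuclideanSpace.single i 1)

/-- `f` has `i`-th partial derivative `f'` at `x`. -/
def HasPD (i : Fin 2) (f : Plane → ℝ) (f' : ℝ) (x : Plane) : Prop :=
  HasLineDerivAt ℝ f f' x (EuclideanSpace.single i 1)

namespace HasPD

variable {i : Fin 2} {f g : Plane → ℝ} {f' g' : ℝ} {x : Plane}

theorem of_contDiff (hf : ContDiff ℝ 1 f) : HasPD i f (pd i f x) x :=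
  ((hf.differentiable (by norm_num)) x).hasFDerivAt.hasLineDerivAt _

theorem pd_eq (hf : HasPD i f f' x) (h : DifferentiableAt ℝ f x) : pd i f x = f' :=
  (h.hasFDerivAt.hasLineDerivAt _).unique hf

theorem add (hf : HasPD i f f' x) (hg : HasPD i g g' x) :
    HasPD i (fun y => f y + g y) (f' + g') x :=
  HasDerivAt.add hf hg

theorem sub (hf : HasPD i f f' x) (hg : HasPD i g g' x) :
    HasPD i (fun y => f y - g y) (f' - g') x :=
  HasDerivAt.sub hf hg

theorem mul (hf : HasPD i f f' x) (hg : HasPD i g g' x) :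
    HasPD i (fun y => f y * g y) (f' * g x + f x * g') x := by
  have := HasDerivAt.mul hf hg
  simp only [zero_smul, add_zero] at this
  exact this

theorem const_mul (c : ℝ) (hf : HasPD i f f' x) : HasPD i (fun y => c * f y) (c * f') x :=
  HasDerivAt.const_mul c hf

theorem exp (hf : HasPD i f f' x) :
    HasPD i (fun y => Real.exp (f y)) (Real.exp (f x) * f') x := by
  have := HasDerivAt.exp hf
  simp only [zero_smul, add_zero] at this
  exact this

theorem const (c : ℝ) : HasPD i (fun _ => c) 0 x := hasDerivAt_const _ _

theorem coord (j : Fin 2) : HasPD i (fun y => y j) (if i = j then 1 else 0) x := by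
  have h := (EuclideanSpace.proj (𝕜 := ℝ) (ι := Fin 2) j).hasFDerivAt (x := x)
  have h2 := h.hasLineDerivAt (EuclideanSpace.single i 1)
  have h3 : (EuclideanSpace.proj (𝕜 := ℝ) (ι := Fin 2) j)
      (EuclideanSpace.single i (1 : ℝ)) = if i = j then 1 else 0 := by
    simp [EuclideanSpace.proj, eq_comm]
  rw [h3] at h2
  exact h2

end HasPD

theorem ContDiff.pd {n k : ℕ∞} {f : Plane → ℝ} (hf : ContDiff ℝ n f) (h : k + 1 ≤ n)
    (i : Fin 2) : ContDiff ℝ k (pd i f) :=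
  (hf.fderiv_right (m := k) (by exact_mod_cast h)).clm_apply contDiff_const

theorem pd_pd_eq_iteratedFDeriv {f : Plane → ℝ} (hf : ContDiff ℝ 2 f) (i j : Fin 2) (x : Plane) :
    pd i (pd j f) x =
      iteratedFDeriv ℝ 2 f x ![EuclideanSpace.single i 1, EuclideanSpace.single j 1] := by
  have hd : DifferentiableAt ℝ (fderiv ℝ f) x :=
    ((hf.fderiv_right (m := 1) (by norm_num)).differentiable (by norm_num)) x
  have : pd j f = fun y => fderiv ℝ f y (EuclideanSpace.single j 1) := rfl
  rw [iteratedFDeriv_two_apply, pd, this, fderiv_clm_apply hd (by fun_prop)]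
  simp

theorem pd_comm {f : Plane → ℝ} (hf : ContDiff ℝ 2 f) (i j : Fin 2) (x : Plane) :
    pd i (pd j f) x = pd j (pd i f) x := by
  rw [pd_pd_eq_iteratedFDeriv hf, pd_pd_eq_iteratedFDeriv hf, iteratedFDeriv_two_apply,
    iteratedFDeriv_two_apply]
  exact (hf.contDiffAt.isSymmSndFDerivAt (by simp)) _ _

theorem laplacian_eq_pd {f : Plane → ℝ} (hf : ContDiff ℝ 2 f) (x : Plane) :
    Laplacian.laplacian f x = pd 0 (pd 0 f) x + pd 1 (pd 1 f) x := by
  rw [InnerProductSpace.laplacian_eq_iteratedFDeriv_orthonormalBasis f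
    (EuclideanSpace.basisFun (Fin 2) ℝ)]
  simp [Fin.sum_univ_two, pd_pd_eq_iteratedFDeriv hf]

theorem pd_eq_zero_of_notMem_tsupport {f : Plane → ℝ} {x : Plane} (hx : x ∉ tsupport f)
    (i : Fin 2) : pd i f x = 0 := by
  have := fderiv_of_notMem_tsupport (𝕜 := ℝ) hx
  simp [pd, this]

theorem tsupport_pd_subset (f : Plane → ℝ) (i : Fin 2) : tsupport (pd i f) ⊆ tsupport f :=
  closure_minimal (fun x hx => by
    by_contra h
    exact hx (pd_eq_zero_of_notMem_tsupport h i)) (isClosed_tsupport f)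

theorem hasCompactSupport_pd {f : Plane → ℝ} (hf : HasCompactSupport f) (i : Fin 2) :
    HasCompactSupport (pd i f) :=
  hf.of_isClosed_subset (isClosed_tsupport _) (tsupport_pd_subset f i)

theorem integrable_pd {f : Plane → ℝ} (hf : ContDiff ℝ 1 f) (hc : HasCompactSupport f)
    (i : Fin 2) : Integrable (pd i f) :=
  (hf.pd (n := 1) (k := 0) (by simp) i).continuous.integrable_of_hasCompactSupport
    (hasCompactSupport_pd hc i)

theorem integral_pd_eq_zero {f : Plane → ℝ} (hf : ContDiff ℝ 1 f) (hc : HasCompactSupport f)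
    (i : Fin 2) : ∫ x, pd i f x = 0 := by
  -- Integration by parts against the constant 1.
  have h := integral_mul_fderiv_eq_neg_fderiv_mul_of_integrable (μ := (volume : Measure Plane))
    (f := fun _ : Plane => (1 : ℝ)) (g := f) (v := EuclideanSpace.single i 1)
    (by simp) (by simp only [one_mul]; exact integrable_pd hf hc i)
    (by simpa using hf.continuous.integrable_of_hasCompactSupport hc)
    (fun _ _ => by fun_prop) (fun x _ => (hf.differentiable (by norm_num)) x)
  simpa [pd] using h

/-! ### Pointwise algebra of the Carleman inequality. -/

theorem abs_mul_le_half_sq_add_sq (x y : ℝ) : |x * y| ≤ (x ^ 2 + y ^ 2) / 2 := by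
  rw [abs_le]
  constructor <;> nlinarith [sq_nonneg (x - y), sq_nonneg (x + y)]

theorem sub_sub_sq_le (x y z : ℝ) : (x - y - z) ^ 2 ≤ 3 * x ^ 2 + 3 * y ^ 2 + 3 * z ^ 2 := by
  nlinarith [sq_nonneg (x + y), sq_nonneg (x + z), sq_nonneg (y - z)]

/-- Supplies the odd power of `τ` needed in `carleman_pointwise`, where only `τ ^ 2` is bounded
below. -/
theorem one_le_one_add_mul_of_sq {B t : ℝ} (hB : 0 ≤ B) (ht : 0 < t) (h : 1 ≤ B * t ^ 2) :
    1 ≤ (1 + B) * t := by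
  rcases le_total 1 t with h1 | h1 <;> nlinarith [mul_nonneg hB ht.le]

/-- Lower bound for the commutator quadratic form: `G` is the difference between the product of the
symmetric part with the multiplier and an exact divergence. -/
theorem commutator_lower_bound {h τ l v a b p q pp pq qq m ma mb W Wa Wb c C K B : ℝ}
    (hh : 0 < h) (hC : 0 ≤ C)
    (hgrad : c * (a ^ 2 + b ^ 2) ≤ 2 * (pp * a ^ 2 + 2 * pq * a * b + qq * b ^ 2)
      - (pp + qq - m) * (a ^ 2 + b ^ 2))
    (hpot : c ≤ 2 * (pp * p ^ 2 + 2 * pq * p * q + qq * q ^ 2)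
      + (pp + qq - m) * (p ^ 2 + q ^ 2))
    (hp : |p| ≤ C) (hq : |q| ≤ C) (hf : |pp + qq - m| ≤ C) (hma : |ma| ≤ C) (hmb : |mb| ≤ C)
    (hW : |W| ≤ C) (hWa : |Wa| ≤ K * τ ^ 2) (hWb : |Wb| ≤ K * τ ^ 2) (hB : 1 ≤ B * τ ^ 2)
    (hhC : 2 * (h * C) ≤ c) :
    c / 2 * (h ^ 2 * (a ^ 2 + b ^ 2))
        + v ^ 2 * τ ^ 2 * (l ^ 2 * c - 2 * C * K - C ^ 2 * B - h * C * B) ≤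
      h ^ 2 * (2 * (pp * a ^ 2 + 2 * pq * a * b + qq * b ^ 2)
        - (pp + qq - m) * (a ^ 2 + b ^ 2)) + h ^ 2 * (v * (ma * a + mb * b))
      + v ^ 2 * (-(Wa * p + Wb * q) - W * (pp + qq - m)
        + τ ^ 2 * l ^ 2 * (2 * (pp * p ^ 2 + 2 * pq * p * q + qq * q ^ 2)
          + (pp + qq - m) * (p ^ 2 + q ^ 2))) := by
  have h1 := mul_le_mul_of_nonneg_left hgrad (sq_nonneg h)
  have h2 := mul_le_mul_of_nonneg_left hpot (by positivity : 0 ≤ v ^ 2 * (τ ^ 2 * l ^ 2))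
  have bound : ∀ {x y X Y : ℝ}, |x| ≤ X → |y| ≤ Y → x * y ≤ X * Y := fun {x y X Y} hx hy =>
    (le_abs_self _).trans ((abs_mul x y).trans_le
      (mul_le_mul hx hy (abs_nonneg _) ((abs_nonneg _).trans hx)))
  have h3 := mul_le_mul_of_nonneg_left (bound hWa hp) (sq_nonneg v)
  have h4 := mul_le_mul_of_nonneg_left (bound hWb hq) (sq_nonneg v)
  have h5 := mul_le_mul_of_nonneg_left (bound hW hf) (sq_nonneg v)
  -- Terms lacking a factor `τ ^ 2` acquire one from `1 ≤ B * τ ^ 2`.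
  have h6 := mul_le_mul_of_nonneg_left hB (by positivity : 0 ≤ v ^ 2 * C ^ 2)
  have h7 := mul_le_mul_of_nonneg_left hB (by positivity : 0 ≤ v ^ 2 * (h * C))
  -- Young's inequality for the term with ∇m; its gradient part is absorbed through `2 * (h * C) ≤
  -- c`, at the price of at most half of `c`.
  have cross : ∀ {n e : ℝ}, |n| ≤ C →
      -(h ^ 2 * (v * (n * e))) ≤ h * C * (v ^ 2 + h ^ 2 * e ^ 2) / 2 := by
    intro n e hn
    have e1 : -(h ^ 2 * (v * (n * e))) ≤ |n| * (h * |v * (h * e)|) := by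
      calc -(h ^ 2 * (v * (n * e))) ≤ |h ^ 2 * (v * (n * e))| := neg_le_abs _
        _ = |n| * (h * |v * (h * e)|) := by
          simp only [abs_mul, abs_pow, abs_of_pos hh]; ring
    have e2 : |v * (h * e)| ≤ (v ^ 2 + h ^ 2 * e ^ 2) / 2 := by
      rw [← mul_pow]; exact abs_mul_le_half_sq_add_sq _ _
    calc _ ≤ |n| * (h * |v * (h * e)|) := e1
      _ ≤ C * (h * ((v ^ 2 + h ^ 2 * e ^ 2) / 2)) := by gcongr
      _ = _ := by ring
  have h8 := cross (e := a) hma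
  have h9 := cross (e := b) hmb
  have h10 := mul_le_mul_of_nonneg_right hhC (by positivity : 0 ≤ h ^ 2 * (a ^ 2 + b ^ 2))
  have h11 : 0 ≤ h * C * (h ^ 2 * (a ^ 2 + b ^ 2)) := by positivity
  linarith

/-- The pointwise Carleman inequality: `F` is the conjugated operator applied to `v`, and `D` is a
divergence. -/
theorem carleman_pointwise {h τ l v a b L p q pp pq qq m ma mb W Wa Wb r w c C K B D : ℝ}
    (hh : 0 < h) (hτ : 0 < τ) (hl : 1 ≤ l) (hC : 0 ≤ C) (hK : 0 ≤ K) (hBn : 0 ≤ B)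
    (hgrad : c * (a ^ 2 + b ^ 2) ≤ 2 * (pp * a ^ 2 + 2 * pq * a * b + qq * b ^ 2)
      - (pp + qq - m) * (a ^ 2 + b ^ 2))
    (hpot : c ≤ 2 * (pp * p ^ 2 + 2 * pq * p * q + qq * q ^ 2)
      + (pp + qq - m) * (p ^ 2 + q ^ 2))
    (hp : |p| ≤ C) (hq : |q| ≤ C) (hf : |pp + qq - m| ≤ C) (hma : |ma| ≤ C) (hmb : |mb| ≤ C)
    (hW : |W| ≤ C) (hWa : |Wa| ≤ K * τ ^ 2) (hWb : |Wb| ≤ K * τ ^ 2) (hB : 1 ≤ B * τ ^ 2)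
    (hr : |r| ≤ w) (hw : w ^ 2 ≤ K * (h * τ ^ 3))
    (hc : 0 < c) (hhC : 2 * (h * C) ≤ c) (hhB : h * C * B ≤ 1)
    (hhl : 3 * (h * (l ^ 2 * C ^ 2)) * (1 + B) ≤ 1)
    (hlc : 2 * C * K + C ^ 2 * B + 3 * K + 3 ≤ l ^ 2 * c)
    (hD : (-h ^ 2 * L + (W - τ ^ 2 * l ^ 2 * (p ^ 2 + q ^ 2)) * v) * (2 * (p * a + q * b) + m * v)
      = D + (h ^ 2 * (2 * (pp * a ^ 2 + 2 * pq * a * b + qq * b ^ 2)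
        - (pp + qq - m) * (a ^ 2 + b ^ 2)) + h ^ 2 * (v * (ma * a + mb * b))
      + v ^ 2 * (-(Wa * p + Wb * q) - W * (pp + qq - m)
        + τ ^ 2 * l ^ 2 * (2 * (pp * p ^ 2 + 2 * pq * p * q + qq * q ^ 2)
          + (pp + qq - m) * (p ^ 2 + q ^ 2))))) :
    h * τ * (c * (h ^ 2 * (a ^ 2 + b ^ 2)) + τ ^ 2 * v ^ 2) ≤
      3 * (-h ^ 2 * L + 2 * h * τ * l * (p * a + q * b) + h * τ * l * (pp + qq) * v
        - τ ^ 2 * l ^ 2 * (p ^ 2 + q ^ 2) * v + (W + r) * v) ^ 2 - 2 * (h * τ * l) * D := by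
  have hG := commutator_lower_bound (v := v) (l := l) hh hC hgrad hpot hp hq hf hma hmb hW hWa
    hWb hB hhC
  set G := h ^ 2 * (2 * (pp * a ^ 2 + 2 * pq * a * b + qq * b ^ 2)
        - (pp + qq - m) * (a ^ 2 + b ^ 2)) + h ^ 2 * (v * (ma * a + mb * b))
      + v ^ 2 * (-(Wa * p + Wb * q) - W * (pp + qq - m)
        + τ ^ 2 * l ^ 2 * (2 * (pp * p ^ 2 + 2 * pq * p * q + qq * q ^ 2)
          + (pp + qq - m) * (p ^ 2 + q ^ 2))) with hGdef
  clear_value G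
  set A := -h ^ 2 * L + (W - τ ^ 2 * l ^ 2 * (p ^ 2 + q ^ 2)) * v with hA
  set M := 2 * (p * a + q * b) + m * v with hM
  set f := pp + qq - m with hf'
  set F := -h ^ 2 * L + 2 * h * τ * l * (p * a + q * b) + h * τ * l * (pp + qq) * v
        - τ ^ 2 * l ^ 2 * (p ^ 2 + q ^ 2) * v + (W + r) * v with hF
  -- Omitting the rough remainder `r` and replacing the Laplacian of the weight by `m` produce the
  -- two error terms.
  have split : A + h * τ * l * M = F - r * v - h * τ * l * f * v := by
    rw [hA, hM, hF, hf']; ring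
  -- 2xy ≤ (x + y)² with x = A and y = hτlM.
  have hAM : 2 * (h * τ * l) * (A * M) ≤ (F - r * v - h * τ * l * f * v) ^ 2 := by
    rw [← split]; linarith [sq_nonneg A, sq_nonneg (h * τ * l * M)]
  have three : (F - r * v - h * τ * l * f * v) ^ 2 ≤
      3 * F ^ 2 + 3 * (r * v) ^ 2 + 3 * (h * τ * l * f * v) ^ 2 := sub_sub_sq_le _ _ _
  have hr2 : r ^ 2 ≤ K * (h * τ ^ 3) := (sq_le_sq' (abs_le.1 hr).1 (abs_le.1 hr).2).trans hw
  have hf2 : f ^ 2 ≤ C ^ 2 := sq_le_sq' (abs_le.1 hf).1 (abs_le.1 hf).2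
  have hrv : (r * v) ^ 2 ≤ K * (h * τ ^ 3) * v ^ 2 := by
    rw [mul_pow]; gcongr
  have hτB : 1 ≤ (1 + B) * τ := one_le_one_add_mul_of_sq hBn hτ hB
  -- This error carries h² where the gain has h, so it is small with h; the missing power of `τ`
  -- comes from `hτB`.
  have hfv : 3 * (h * τ * l * f * v) ^ 2 ≤ h * τ ^ 3 * v ^ 2 := by
    calc 3 * (h * τ * l * f * v) ^ 2 = 3 * (h * (l ^ 2 * f ^ 2)) * (h * τ ^ 2 * v ^ 2) * 1 := by ring
      _ ≤ 3 * (h * (l ^ 2 * C ^ 2)) * (h * τ ^ 2 * v ^ 2) * ((1 + B) * τ) := by gcongr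
      _ = 3 * (h * (l ^ 2 * C ^ 2)) * (1 + B) * (h * τ ^ 3 * v ^ 2) := by ring
      _ ≤ 1 * (h * τ ^ 3 * v ^ 2) := by gcongr
      _ = _ := one_mul _
  -- `hlc` leaves 3K + 3, of which `hhB` costs at most 1. The rest, doubled, pays for 3K from `hrv`
  -- and 1 from `hfv`, and still leaves the gain.
  have hGl : c / 2 * (h ^ 2 * (a ^ 2 + b ^ 2)) + v ^ 2 * τ ^ 2 * (3 * K + 2) ≤ G := by
    refine le_trans ?_ hG
    gcongr
    linarith
  have hGl2 : h * τ * (c * (h ^ 2 * (a ^ 2 + b ^ 2)) + 2 * (v ^ 2 * τ ^ 2 * (3 * K + 2)))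
      ≤ 2 * (h * τ * l) * G := by
    have hnn : 0 ≤ c / 2 * (h ^ 2 * (a ^ 2 + b ^ 2)) + v ^ 2 * τ ^ 2 * (3 * K + 2) := by positivity
    calc _ = 2 * (h * τ * 1) *
          (c / 2 * (h ^ 2 * (a ^ 2 + b ^ 2)) + v ^ 2 * τ ^ 2 * (3 * K + 2)) := by ring
      _ ≤ 2 * (h * τ * l) * G := by gcongr
  have hpos : 0 ≤ h * τ ^ 3 * v ^ 2 := by positivity
  have hpos2 : 0 ≤ K * (h * τ ^ 3 * v ^ 2) := by positivity
  have e1 : 2 * (h * τ * l) * (A * M) = 2 * (h * τ * l) * D + 2 * (h * τ * l) * G := by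
    rw [hD]; ring
  linarith

/-! ### The divergence identity. -/

/-- The product of the symmetric part of the conjugated operator with a first order multiplier is
an exact divergence plus a quadratic form in `v` and `∇v`. -/
theorem exists_divergence_identity {φ m W v : Plane → ℝ} (hφ : ContDiff ℝ ∞ φ)
    (hm : ContDiff ℝ 1 m) (hW : ContDiff ℝ 1 W) (hv : ContDiff ℝ ∞ v) (hvc : HasCompactSupport v)
    (h k : ℝ) :
    ∃ D : Plane → ℝ, Integrable D ∧ ∫ x, D x = 0 ∧ (∀ x, x ∉ tsupport v → D x = 0) ∧
      ∀ x, (-h ^ 2 * (pd 0 (pd 0 v) x + pd 1 (pd 1 v) x)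
          + (W x - k * (pd 0 φ x ^ 2 + pd 1 φ x ^ 2)) * v x)
          * (2 * (pd 0 φ x * pd 0 v x + pd 1 φ x * pd 1 v x) + m x * v x)
        = D x + (h ^ 2 * (2 * (pd 0 (pd 0 φ) x * pd 0 v x ^ 2
              + 2 * pd 0 (pd 1 φ) x * pd 0 v x * pd 1 v x + pd 1 (pd 1 φ) x * pd 1 v x ^ 2)
            - (pd 0 (pd 0 φ) x + pd 1 (pd 1 φ) x - m x) * (pd 0 v x ^ 2 + pd 1 v x ^ 2))
          + h ^ 2 * (v x * (pd 0 m x * pd 0 v x + pd 1 m x * pd 1 v x))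
          + v x ^ 2 * (-(pd 0 W x * pd 0 φ x + pd 1 W x * pd 1 φ x)
            - W x * (pd 0 (pd 0 φ) x + pd 1 (pd 1 φ) x - m x)
            + k * (2 * (pd 0 (pd 0 φ) x * pd 0 φ x ^ 2
                + 2 * pd 0 (pd 1 φ) x * pd 0 φ x * pd 1 φ x + pd 1 (pd 1 φ) x * pd 1 φ x ^ 2)
              + (pd 0 (pd 0 φ) x + pd 1 (pd 1 φ) x - m x) * (pd 0 φ x ^ 2 + pd 1 φ x ^ 2)))) := by
  have hφ1 : ∀ i, ContDiff ℝ 1 (pd i φ) := fun i => hφ.pd (n := ⊤) (k := 1) le_top i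
  have hv1 : ∀ i, ContDiff ℝ 1 (pd i v) := fun i => hv.pd (n := ⊤) (k := 1) le_top i
  have hv0 : ContDiff ℝ 1 v := hv.of_le (by exact_mod_cast le_top)
  -- A Rellich–Pohozaev field for -h²Δv against 2∇φ·∇v, the flux of mv, and a potential part from
  -- 2v∇v = ∇(v²). The last one differentiates `W`, hence the need for a C¹ potential.
  let X : Fin 2 → Plane → ℝ := fun i x =>
    h ^ 2 * (-2 * ((pd 0 φ x * pd 0 v x + pd 1 φ x * pd 1 v x) * pd i v x)
      + pd i φ x * (pd 0 v x * pd 0 v x + pd 1 v x * pd 1 v x) - m x * (v x * pd i v x))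
    + (W x - k * (pd 0 φ x * pd 0 φ x + pd 1 φ x * pd 1 φ x)) * ((v x * v x) * pd i φ x)
  have hX : ∀ i, ContDiff ℝ 1 (X i) := fun i => by
    have := hφ1 0; have := hφ1 1; have := hv1 0; have := hv1 1; have := hφ1 i; have := hv1 i
    fun_prop
  have hXs : ∀ i, tsupport (X i) ⊆ tsupport v := fun i =>
    closure_minimal (fun x hx => by
      by_contra hn
      apply hx
      simp [X, pd_eq_zero_of_notMem_tsupport hn, image_eq_zero_of_notMem_tsupport hn])
      (isClosed_tsupport v)
  have hXc : ∀ i, HasCompactSupport (X i) := fun i =>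
    hvc.of_isClosed_subset (isClosed_tsupport _) (hXs i)
  refine ⟨fun x => pd 0 (X 0) x + pd 1 (X 1) x,
    (integrable_pd (hX 0) (hXc 0) 0).add (integrable_pd (hX 1) (hXc 1) 1), ?_, ?_, ?_⟩
  · rw [integral_add (integrable_pd (hX 0) (hXc 0) 0) (integrable_pd (hX 1) (hXc 1) 1),
      integral_pd_eq_zero (hX 0) (hXc 0), integral_pd_eq_zero (hX 1) (hXc 1), add_zero]
  · intro x hx
    beta_reduce
    rw [pd_eq_zero_of_notMem_tsupport (fun h' => hx (hXs 0 h')),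
      pd_eq_zero_of_notMem_tsupport (fun h' => hx (hXs 1 h')), add_zero]
  · intro x
    have d : ∀ i, HasPD i (X i) _ x := fun i =>
      ((((((((HasPD.of_contDiff (hφ1 0)).mul (.of_contDiff (hv1 0))).add
        ((HasPD.of_contDiff (hφ1 1)).mul (.of_contDiff (hv1 1)))).mul
          (.of_contDiff (hv1 i))).const_mul (-2)).add
        ((HasPD.of_contDiff (hφ1 i)).mul
          (((HasPD.of_contDiff (hv1 0)).mul (.of_contDiff (hv1 0))).add
            ((HasPD.of_contDiff (hv1 1)).mul (.of_contDiff (hv1 1)))))).sub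
        ((HasPD.of_contDiff hm).mul ((HasPD.of_contDiff hv0).mul
          (.of_contDiff (hv1 i))))).const_mul (h ^ 2)).add
      (((HasPD.of_contDiff hW).sub
        ((((HasPD.of_contDiff (hφ1 0)).mul (.of_contDiff (hφ1 0))).add
          ((HasPD.of_contDiff (hφ1 1)).mul (.of_contDiff (hφ1 1)))).const_mul k)).mul
        (((HasPD.of_contDiff hv0).mul (.of_contDiff hv0)).mul (.of_contDiff (hφ1 i))))
    beta_reduce
    rw [(d 0).pd_eq ((hX 0).differentiable (by norm_num) x),
      (d 1).pd_eq ((hX 1).differentiable (by norm_num) x),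
      pd_comm (contDiff_infty.1 hφ 2) 1 0,
      pd_comm (contDiff_infty.1 hv 2) 1 0]
    ring

/-! ### Conjugation by the exponential weight. -/

/-- The real operator `-h²Δ + V - E`. -/
noncomputable def realSchrodinger (h : ℝ) (V : Plane → ℝ) (E : ℝ) (u : Plane → ℝ) (x : Plane) : ℝ :=
  -h ^ 2 * (pd 0 (pd 0 u) x + pd 1 (pd 1 u) x) + (V x - E) * u x

/-- Convexity-type conditions on a Carleman weight `φ` with auxiliary multiplier `m` on a set. -/
structure CarlemanWeight (φ m : Plane → ℝ) (c C : ℝ) (S : Set Plane) : Prop where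
  contDiff : ContDiff ℝ ∞ φ
  contDiff_multiplier : ContDiff ℝ ∞ m
  pos : 0 < c
  nonneg : 0 ≤ C
  hess_ge : ∀ x ∈ S, ∀ a b : ℝ, c * (a ^ 2 + b ^ 2) ≤
    2 * (pd 0 (pd 0 φ) x * a ^ 2 + 2 * pd 0 (pd 1 φ) x * a * b + pd 1 (pd 1 φ) x * b ^ 2)
      - (pd 0 (pd 0 φ) x + pd 1 (pd 1 φ) x - m x) * (a ^ 2 + b ^ 2)
  hess_grad_ge : ∀ x ∈ S, c ≤
    2 * (pd 0 (pd 0 φ) x * pd 0 φ x ^ 2 + 2 * pd 0 (pd 1 φ) x * pd 0 φ x * pd 1 φ x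
        + pd 1 (pd 1 φ) x * pd 1 φ x ^ 2)
      + (pd 0 (pd 0 φ) x + pd 1 (pd 1 φ) x - m x) * (pd 0 φ x ^ 2 + pd 1 φ x ^ 2)
  abs_pd_le : ∀ x ∈ S, ∀ i, |pd i φ x| ≤ C
  abs_pd_multiplier_le : ∀ x ∈ S, ∀ i, |pd i m x| ≤ C
  abs_laplacian_sub_le : ∀ x ∈ S, |pd 0 (pd 0 φ) x + pd 1 (pd 1 φ) x - m x| ≤ C

/-- The pointwise inequality for v = e^{sφ}u with s = τl/h, rewritten for `u`. The divergence `D`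
drops out on integration, and the rough `V` is never differentiated. -/
theorem exists_carleman_density {φ m : Plane → ℝ} {c C : ℝ} {S : Set Plane}
    (hφ : CarlemanWeight φ m c C S) {h τ l K B w E : ℝ} {V Vt u : Plane → ℝ}
    (hu : ContDiff ℝ ∞ u) (huc : HasCompactSupport u) (huS : tsupport u ⊆ S)
    (hh : 0 < h) (hτ : 0 < τ) (hl : 1 ≤ l) (hK : 0 ≤ K) (hBn : 0 ≤ B)
    (hVt : ContDiff ℝ 1 Vt) (hVE : ∀ x ∈ S, |Vt x - E| ≤ C)
    (hVtd : ∀ x ∈ S, ∀ i, |pd i Vt x| ≤ K * τ ^ 2) (hVV : ∀ x ∈ S, |V x - Vt x| ≤ w)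
    (hB : 1 ≤ B * τ ^ 2) (hw : w ^ 2 ≤ K * (h * τ ^ 3))
    (hhC : 2 * (h * C) ≤ c) (hhB : h * C * B ≤ 1)
    (hhl : 3 * (h * (l ^ 2 * C ^ 2)) * (1 + B) ≤ 1)
    (hlc : 2 * C * K + C ^ 2 * B + 3 * K + 3 ≤ l ^ 2 * c) :
    ∃ D : Plane → ℝ, Integrable D ∧ ∫ x, D x = 0 ∧ (∀ x, x ∉ tsupport u → D x = 0) ∧
      ∀ x, h * τ * (Real.exp (τ / h * l * φ x) ^ 2 *
          (u x ^ 2 + h ^ 2 * (pd 0 u x ^ 2 + pd 1 u x ^ 2)))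
        ≤ (2 / c + B + 4 * C ^ 2 * l ^ 2) *
          (3 * (Real.exp (τ / h * l * φ x) ^ 2 * realSchrodinger h V E u x ^ 2) - D x) := by
  have hφ0 : ContDiff ℝ 1 φ := hφ.contDiff.of_le (by exact_mod_cast le_top)
  have hφ1 : ∀ i, ContDiff ℝ 1 (pd i φ) := fun i => hφ.contDiff.pd (n := ⊤) (k := 1) le_top i
  have hu1 : ∀ i, ContDiff ℝ 1 (pd i u) := fun i => hu.pd (n := ⊤) (k := 1) le_top i
  have hu0 : ContDiff ℝ 1 u := hu.of_le (by exact_mod_cast le_top)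
  set s := τ / h * l with hs
  have hsh : h * s = τ * l := by rw [hs]; field_simp
  have hex : ContDiff ℝ ∞ (fun x => Real.exp (s * φ x)) := (contDiff_const.mul hφ.contDiff).exp
  set v : Plane → ℝ := fun x => Real.exp (s * φ x) * u x with hvdef
  have hv : ContDiff ℝ ∞ v := hex.mul hu
  have hvs : tsupport v = tsupport u := by
    rw [tsupport, tsupport]; congr 1; ext x; simp [hvdef]
  have hvc : HasCompactSupport v := by rw [HasCompactSupport, hvs]; exact huc
  have dexp : ∀ i x, HasPD i (fun x => Real.exp (s * φ x)) _ x := fun i x =>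
    ((HasPD.of_contDiff hφ0).const_mul s).exp
  have hv1 : ∀ i x, pd i v x = Real.exp (s * φ x) * (pd i u x + s * (pd i φ x * u x)) :=
    fun i x => by
      rw [((dexp i x).mul (HasPD.of_contDiff hu0)).pd_eq (hv.differentiable (by simp) x)]
      ring
  have hv2 : ∀ i x, pd i (pd i v) x = Real.exp (s * φ x) * (pd i (pd i u) x
      + 2 * s * (pd i φ x * pd i u x) + s * pd i (pd i φ) x * u x
      + s ^ 2 * pd i φ x ^ 2 * u x) := fun i x => by
    have e : pd i v = fun x => Real.exp (s * φ x) * (pd i u x + s * (pd i φ x * u x)) :=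
      funext (hv1 i)
    have hd : ContDiff ℝ 1 (pd i v) := hv.pd (n := ⊤) (k := 1) le_top i
    have hd2 := hd.differentiable (by norm_num) x
    rw [e] at hd2 ⊢
    rw [((dexp i x).mul ((HasPD.of_contDiff (hu1 i)).add
      (((HasPD.of_contDiff (hφ1 i)).mul (HasPD.of_contDiff hu0)).const_mul s))).pd_eq hd2]
    ring
  have hWE : ContDiff ℝ 1 (fun x => Vt x - E) := hVt.sub contDiff_const
  have hWEd : ∀ i x, pd i (fun x => Vt x - E) x = pd i Vt x := fun i x => by
    rw [((HasPD.of_contDiff hVt).sub (HasPD.const E)).pd_eq (hWE.differentiable (by norm_num) x),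
      sub_zero]
  obtain ⟨D, hDi, hD0, hDs, hD⟩ := exists_divergence_identity hφ.contDiff
    (hφ.contDiff_multiplier.of_le (by exact_mod_cast le_top)) hWE hv hvc h (τ ^ 2 * l ^ 2)
  refine ⟨fun x => 2 * (h * τ * l) * D x, hDi.const_mul _, ?_, ?_, ?_⟩
  · rw [integral_const_mul, hD0, mul_zero]
  · intro x hx
    simp only [hDs x (hvs ▸ hx), mul_zero]
  intro x
  by_cases hx : x ∈ tsupport u
  swap
  · have z : ∀ i, pd i (pd i u) x = 0 := fun i =>
      pd_eq_zero_of_notMem_tsupport (fun h' => hx (tsupport_pd_subset u i h')) i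
    simp [hDs x (hvs ▸ hx), realSchrodinger, pd_eq_zero_of_notMem_tsupport hx, z,
      image_eq_zero_of_notMem_tsupport hx]
  have hxS := huS hx
  have hDx := hD x
  rw [hWEd, hWEd] at hDx
  have key := carleman_pointwise (r := V x - Vt x) (w := w) hh hτ hl hφ.nonneg hK hBn
    (hφ.hess_ge x hxS _ _) (hφ.hess_grad_ge x hxS) (hφ.abs_pd_le x hxS 0) (hφ.abs_pd_le x hxS 1)
    (hφ.abs_laplacian_sub_le x hxS) (hφ.abs_pd_multiplier_le x hxS 0)
    (hφ.abs_pd_multiplier_le x hxS 1) (hVE x hxS) (hVtd x hxS 0) (hVtd x hxS 1) hB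
    (hVV x hxS) hw hφ.pos hhC hhB hhl hlc hDx
  -- Conjugation: the left side is e^{sφ} times the operator on `u`, once `h * s = τ * l` has
  -- eliminated `τ` and `l`.
  have hF : -h ^ 2 * (pd 0 (pd 0 v) x + pd 1 (pd 1 v) x)
      + 2 * h * τ * l * (pd 0 φ x * pd 0 v x + pd 1 φ x * pd 1 v x)
      + h * τ * l * (pd 0 (pd 0 φ) x + pd 1 (pd 1 φ) x) * v x
      - τ ^ 2 * l ^ 2 * (pd 0 φ x ^ 2 + pd 1 φ x ^ 2) * v x + (Vt x - E + (V x - Vt x)) * v x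
      = Real.exp (s * φ x) * realSchrodinger h V E u x := by
    have e1 : 2 * h * τ * l = 2 * h ^ 2 * s := by linear_combination (-2 * h) * hsh
    have e2 : h * τ * l = h ^ 2 * s := by linear_combination (-h) * hsh
    have e3 : τ ^ 2 * l ^ 2 = h ^ 2 * s ^ 2 := by
      linear_combination (-(h * s) - τ * l) * hsh
    rw [e1, e2, e3, hv1, hv1, hv2, hv2, realSchrodinger]
    simp only [hvdef]
    ring
  have hve : Real.exp (s * φ x) ^ 2 * u x ^ 2 = v x ^ 2 := by simp only [hvdef]; ring
  rw [hF, mul_pow (Real.exp (s * φ x)) (realSchrodinger h V E u x)] at key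
  have hA : 0 ≤ 2 / c + B + 4 * C ^ 2 * l ^ 2 := by have := hφ.pos; positivity
  refine le_trans ?_ (mul_le_mul_of_nonneg_left key hA)
  rw [mul_left_comm _ (h * τ)]
  refine mul_le_mul_of_nonneg_left ?_ (by positivity)
  -- Differentiating the exponential costs τl∂ᵢφ·v; this is the source of 4C²l² in the constant.
  have g : ∀ i, h ^ 2 * (Real.exp (s * φ x) * pd i u x) ^ 2 ≤
      2 * (h ^ 2 * pd i v x ^ 2) + 2 * (C ^ 2 * l ^ 2 * τ ^ 2 * v x ^ 2) := fun i => by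
    have e : h * (Real.exp (s * φ x) * pd i u x) = h * pd i v x - τ * l * (pd i φ x * v x) := by
      rw [hv1, ← hsh]; simp only [hvdef]; ring
    have e2 : pd i φ x ^ 2 ≤ C ^ 2 :=
      sq_le_sq' (abs_le.1 (hφ.abs_pd_le x hxS i)).1 (abs_le.1 (hφ.abs_pd_le x hxS i)).2
    have e3 : (τ * l * (pd i φ x * v x)) ^ 2 ≤ C ^ 2 * l ^ 2 * τ ^ 2 * v x ^ 2 := by
      calc _ = pd i φ x ^ 2 * (l ^ 2 * τ ^ 2 * v x ^ 2) := by ring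
        _ ≤ C ^ 2 * (l ^ 2 * τ ^ 2 * v x ^ 2) := by gcongr
        _ = _ := by ring
    rw [← mul_pow, e]
    linarith [sq_nonneg (h * pd i v x + τ * l * (pd i φ x * v x))]
  have g0 := g 0
  have g1 := g 1
  have hvB : v x ^ 2 ≤ B * τ ^ 2 * v x ^ 2 := le_mul_of_one_le_left (sq_nonneg _) hB
  have hc := hφ.pos
  have hcc : 2 / c * (c * (h ^ 2 * (pd 0 v x ^ 2 + pd 1 v x ^ 2)))
      = 2 * (h ^ 2 * (pd 0 v x ^ 2 + pd 1 v x ^ 2)) := by field_simp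
  have t1 : 0 ≤ 2 / c * (τ ^ 2 * v x ^ 2) := by positivity
  have t2 : 0 ≤ (B + 4 * C ^ 2 * l ^ 2) * (c * (h ^ 2 * (pd 0 v x ^ 2 + pd 1 v x ^ 2))) := by
    positivity
  calc Real.exp (s * φ x) ^ 2 * (u x ^ 2 + h ^ 2 * (pd 0 u x ^ 2 + pd 1 u x ^ 2))
      = v x ^ 2 + (h ^ 2 * (Real.exp (s * φ x) * pd 0 u x) ^ 2
        + h ^ 2 * (Real.exp (s * φ x) * pd 1 u x) ^ 2) := by rw [← hve]; ring
    _ ≤ _ := by linarith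

/-! ### Bounds on the oscillation. -/

section Oscillation

variable {R₀ R₁ M : ℝ} {V W : Plane → ℝ}

/-- Boundedness of `W` matters: the real supremum of an unbounded family is 0 by default. -/
theorem abs_sub_le_localOscillation (hW : ∀ x, |W x| ≤ M) {θ : ℝ} {x t : Plane}
    (hx : x ∈ Metric.ball (0 : Plane) R₀) (ht : t ∈ Metric.ball (0 : Plane) θ) :
    |W (x - t) - W x| ≤ localOscillation R₀ W θ := by
  have hb : ∀ x t : Plane, |W (x - t) - W x| ≤ 2 * M := fun x t =>
    (abs_sub _ _).trans (by linarith [hW (x - t), hW x])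
  have hM : 0 ≤ 2 * M := (abs_nonneg _).trans (hb 0 0)
  have h1 : |W (x - t) - W x| ≤ ⨆ t : Metric.ball (0 : Plane) θ, |W (x - (t : Plane)) - W x| :=
    le_ciSup (f := fun t : Metric.ball (0 : Plane) θ => |W (x - (t : Plane)) - W x|)
      ⟨2 * M, by rintro _ ⟨t, rfl⟩; exact hb _ _⟩ ⟨t, ht⟩
  refine h1.trans ?_
  exact le_ciSup (f := fun x₀ : Metric.ball (0 : Plane) R₀ =>
      ⨆ t : Metric.ball (0 : Plane) θ, |W ((x₀ : Plane) - (t : Plane)) - W (x₀ : Plane)|)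
      ⟨2 * M, by rintro _ ⟨x, rfl⟩; exact Real.iSup_le (fun t => hb _ _) hM⟩ ⟨x, hx⟩

theorem localOscillation_le (hW : ∀ x, |W x| ≤ M) (θ : ℝ) :
    localOscillation R₀ W θ ≤ 2 * M := by
  have hb : ∀ x t : Plane, |W (x - t) - W x| ≤ 2 * M := fun x t =>
    (abs_sub _ _).trans (by linarith [hW (x - t), hW x])
  have hM : 0 ≤ 2 * M := (abs_nonneg _).trans (hb 0 0)
  exact Real.iSup_le (fun x => Real.iSup_le (fun t => hb _ _) hM) hM

/-- The oscillation of a function that is not constant on the ball is at least linear. -/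
theorem le_localOscillation_of_ne (hW : ∀ x, |W x| ≤ M) {y : Plane}
    (hy : y ∈ Metric.ball (0 : Plane) R₀) {θ : ℝ} (hθ : 0 < θ) (hθ1 : θ ≤ 1) :
    θ * |W y - W 0| ≤ (‖y‖ + 2) * localOscillation R₀ W θ := by
  -- The segment from 0 to `y` is cut into `N` steps, each shorter than `θ`; it stays in the ball.
  set N : ℕ := ⌊‖y‖ / θ⌋₊ + 1 with hN
  have hN0 : (0 : ℝ) < N := by positivity
  have hNy : ‖y‖ < N * θ := by
    rw [← div_lt_iff₀ hθ]; push_cast [hN]; exact Nat.lt_floor_add_one _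
  have hNu : N * θ ≤ ‖y‖ + θ := by
    have := Nat.floor_le (div_nonneg (norm_nonneg y) hθ.le)
    rw [le_div_iff₀ hθ] at this
    push_cast [hN]; linarith
  have hη : 0 ≤ localOscillation R₀ W θ :=
    (abs_nonneg _).trans (abs_sub_le_localOscillation hW
      (x := y) (t := 0) hy (by simpa using hθ))
  have chain : ∀ k : ℕ, k ≤ N → |W (((k : ℝ) / N) • y) - W 0| ≤ k * localOscillation R₀ W θ := by
    intro k
    induction k with
    | zero => intro _; simp
    | succ k ih =>
      intro hk
      have hk' := ih (by omega)
      have hkN : ((k + 1 : ℕ) : ℝ) / N ≤ 1 := (div_le_one hN0).2 (by exact_mod_cast hk)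
      have hin : (((k + 1 : ℕ) : ℝ) / N) • y ∈ Metric.ball (0 : Plane) R₀ := by
        rw [mem_ball_zero_iff] at hy ⊢
        rw [norm_smul, Real.norm_of_nonneg (by positivity)]
        exact (mul_le_of_le_one_left (norm_nonneg _) hkN).trans_lt hy
      have ht : (1 / (N : ℝ)) • y ∈ Metric.ball (0 : Plane) θ := by
        rw [mem_ball_zero_iff, norm_smul, Real.norm_of_nonneg (by positivity), one_div,
          inv_mul_lt_iff₀ hN0]
        exact hNy
      have hs := abs_sub_le_localOscillation hW hin ht
      rw [← sub_smul, show ((k + 1 : ℕ) : ℝ) / N - 1 / N = (k : ℝ) / N by push_cast; ring] at hs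
      rw [abs_sub_comm] at hs
      have := abs_sub_le (W ((((k + 1 : ℕ) : ℝ) / N) • y)) (W (((k : ℝ) / N) • y)) (W 0)
      push_cast at *
      linarith
  have hfin := chain N le_rfl
  rw [div_self hN0.ne', one_smul] at hfin
  calc θ * |W y - W 0| ≤ θ * (N * localOscillation R₀ W θ) := by gcongr
    _ = (N * θ) * localOscillation R₀ W θ := by ring
    _ ≤ (‖y‖ + 2) * localOscillation R₀ W θ := by gcongr; linarith

end Oscillation

/-! ### Mollification at the scale of the modulus. -/

section Mollification

/-- There is a constant controlling the mollification at every scale by the oscillation. -/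
theorem exists_mollification_bound : ∃ K : ℝ, 0 < K ∧ ∀ (W : Plane → ℝ) (M : ℝ),
    Integrable W → (∀ x, |W x| ≤ M) → ∀ θ : ℝ, 0 < θ → ∃ Wt : Plane → ℝ, ContDiff ℝ 1 Wt ∧
      ∀ (x : Plane) (η : ℝ), (∀ t ∈ Metric.ball (0 : Plane) θ, |W (x - t) - W x| ≤ η) →
        |W x - Wt x| ≤ η ∧ ∀ i, |pd i Wt x| ≤ K * (η / θ) := by
  -- Outer radius 1, so that the kernel rescaled by `θ` vanishes off B(0, θ).
  let f : ContDiffBump (0 : Plane) := ⟨1 / 2, 1, by norm_num, by norm_num⟩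
  let ρ : Plane → ℝ := f.normed volume
  have hρ : ContDiff ℝ 1 ρ := f.contDiff_normed (n := 1)
  have hρc : HasCompactSupport ρ := f.hasCompactSupport_normed
  have hρi : ∀ i, Integrable (pd i ρ) := integrable_pd hρ hρc
  let K : ℝ := (∫ x, |pd 0 ρ x|) + (∫ x, |pd 1 ρ x|) + 1
  have hn : ∀ i, 0 ≤ ∫ x, |pd i ρ x| := fun i => integral_nonneg fun _ => abs_nonneg _
  have hKi : ∀ i, ∫ x, |pd i ρ x| ≤ K := by
    have := hn 0; have := hn 1
    intro i; fin_cases i <;> simp [K] <;> linarith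
  refine ⟨K, by have := hn 0; have := hn 1; simp only [K]; linarith, ?_⟩
  intro W M hWi hWM θ hθ
  let σ : Plane → ℝ := fun t => θ⁻¹ ^ 2 * ρ (θ⁻¹ • t)
  have hσ : ContDiff ℝ 1 σ := contDiff_const.mul (hρ.comp (contDiff_const_smul _))
  have hfr : Module.finrank ℝ Plane = 2 := by simp
  have scale : ∀ g : Plane → ℝ, ∫ t, θ⁻¹ ^ 2 * g (θ⁻¹ • t) = ∫ t, g t := fun g => by
    rw [integral_const_mul, Measure.integral_comp_smul, hfr, smul_eq_mul, abs_of_pos (by positivity)]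
    field_simp
  have hσc : HasCompactSupport σ := (hρc.comp_smul (inv_ne_zero hθ.ne')).mul_left
  have hσ1 : ∫ t, σ t = 1 := by rw [scale]; exact f.integral_normed
  have hσ0 : ∀ t, 0 ≤ σ t := fun t => mul_nonneg (by positivity) (f.nonneg_normed _)
  have hσz : ∀ t, t ∉ Metric.ball (0 : Plane) θ → σ t = 0 := by
    intro t ht
    have : θ⁻¹ • t ∉ Function.support ρ := by
      rw [f.support_normed_eq, mem_ball_zero_iff, norm_smul, Real.norm_of_nonneg (by positivity),
        inv_mul_lt_iff₀ hθ]
      have h1 : f.rOut = 1 := rfl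
      simpa [h1] using ht
    simp only [σ, Function.notMem_support.1 this, mul_zero]
  have hσd : ∀ i t, pd i σ t = θ⁻¹ * (θ⁻¹ ^ 2 * pd i ρ (θ⁻¹ • t)) := by
    intro i t
    have h1 : HasFDerivAt σ (θ⁻¹ ^ 2 • (fderiv ℝ ρ (θ⁻¹ • t) ∘L
        (θ⁻¹ • ContinuousLinearMap.id ℝ Plane))) t :=
      (((hρ.differentiable (by norm_num)) _).hasFDerivAt.comp t
        ((hasFDerivAt_id t).const_smul θ⁻¹)).const_mul _
    rw [pd, h1.fderiv]
    simp [pd]; ring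
  -- A zero of the nonnegative `σ` is a minimum, which also settles the boundary circle.
  have hσdz : ∀ i t, t ∉ Metric.ball (0 : Plane) θ → pd i σ t = 0 := by
    intro i t ht
    have hmin : IsLocalMin σ t := Filter.Eventually.of_forall fun s => by
      rw [hσz t ht]; exact hσ0 s
    rw [pd, hmin.fderiv_eq_zero]; rfl
  have hWl : LocallyIntegrable W volume := hWi.locallyIntegrable
  refine ⟨MeasureTheory.convolution σ W (ContinuousLinearMap.lsmul ℝ ℝ) volume,
    hσc.contDiff_convolution_left _ hσ hWl, ?_⟩
  intro x η hη
  have hWb : AEStronglyMeasurable (fun t => W (x - t)) volume :=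
    (hWi.comp_sub_left x).aestronglyMeasurable
  have hint : ∀ {g : Plane → ℝ}, Integrable g → Integrable (fun t => g t * W (x - t)) :=
    fun {g} hg => hg.mul_bdd (c := M) hWb (.of_forall fun t => hWM _)
  have comm : ∀ {g : Plane → ℝ}, Integrable g →
      (∀ t, t ∉ Metric.ball (0 : Plane) θ → g t = 0) →
      |∫ t, g t * (W (x - t) - W x)| ≤ η * ∫ t, |g t| := by
    intro g hg hgz
    rw [← integral_const_mul, ← Real.norm_eq_abs]
    refine norm_integral_le_of_norm_le (hg.abs.const_mul η) (.of_forall fun t => ?_)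
    rw [Real.norm_eq_abs, abs_mul, mul_comm]
    by_cases ht : t ∈ Metric.ball (0 : Plane) θ
    · exact mul_le_mul_of_nonneg_right (hη t ht) (abs_nonneg _)
    · simp [hgz t ht]
  have hσi : Integrable σ := hσ.continuous.integrable_of_hasCompactSupport hσc
  have hσdi := integrable_pd hσ hσc
  have sub : ∀ {g : Plane → ℝ}, Integrable g → ∫ t, g t * (W (x - t) - W x) =
      (∫ t, g t * W (x - t)) - (∫ t, g t) * W x := fun {g} hg => by
    simp_rw [mul_sub]
    rw [integral_sub (hint hg) (hg.mul_const _), integral_mul_const]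
  constructor
  · have e : MeasureTheory.convolution σ W (ContinuousLinearMap.lsmul ℝ ℝ) volume x
        = ∫ t, σ t * W (x - t) := rfl
    have h1 := comm hσi hσz
    rw [sub hσi, hσ1, one_mul, ← e] at h1
    simp_rw [abs_of_nonneg (hσ0 _)] at h1
    rwa [hσ1, mul_one, abs_sub_comm] at h1
  · intro i
    have hd := hσc.hasFDerivAt_convolution_left (ContinuousLinearMap.lsmul ℝ ℝ) hσ hWl x
    have e : pd i (MeasureTheory.convolution σ W (ContinuousLinearMap.lsmul ℝ ℝ) volume) x
        = ∫ t, pd i σ t * W (x - t) := by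
      rw [pd, hd.fderiv, MeasureTheory.convolution]
      have hex : ConvolutionExistsAt (fderiv ℝ σ) W x
          ((ContinuousLinearMap.lsmul ℝ ℝ).precompL Plane) volume :=
        ((hσc.fderiv ℝ).convolutionExists_left _ (hσ.continuous_fderiv (by norm_num)) hWl) x
      rw [ContinuousLinearMap.integral_apply hex]
      rfl
    -- ∂ᵢσ has mean zero, so W x may be subtracted under the integral and only the oscillation about
    -- x remains.
    have h1 := comm (hσdi i) (hσdz i)
    rw [sub (hσdi i), integral_pd_eq_zero hσ hσc, zero_mul, sub_zero, ← e] at h1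
    have e2 : ∫ t, |pd i σ t| = θ⁻¹ * ∫ t, |pd i ρ t| := by
      rw [← scale (fun t => |pd i ρ t|), ← integral_const_mul]
      congr 1; ext t
      rw [hσd, abs_mul, abs_mul, abs_of_pos (by positivity : 0 < θ⁻¹),
        abs_of_pos (by positivity : 0 < θ⁻¹ ^ 2)]
    have hη0 : 0 ≤ η := (abs_nonneg _).trans (hη 0 (by simpa using hθ))
    calc _ ≤ _ := h1
      _ = (η / θ) * ∫ t, |pd i ρ t| := by rw [e2]; ring
      _ ≤ (η / θ) * K := by have := hKi i; gcongr
      _ = _ := mul_comm _ _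

end Mollification

/-! ### Gaussian Carleman weights. -/

/-- The Gaussian centred at `z` with rate `a`. -/
noncomputable def gaussian (a : ℝ) (z x : Plane) : ℝ :=
  Real.exp (-a * ((x 0 - z 0) * (x 0 - z 0) + (x 1 - z 1) * (x 1 - z 1)))

theorem gaussian_eq (a : ℝ) (z x : Plane) : gaussian a z x = Real.exp (-a * ‖x - z‖ ^ 2) := by
  rw [gaussian, EuclideanSpace.real_norm_sq_eq, Fin.sum_univ_two]
  simp [sq]

theorem gaussian_pos (a : ℝ) (z x : Plane) : 0 < gaussian a z x := Real.exp_pos _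

theorem contDiff_coord (i : Fin 2) : ContDiff ℝ ∞ (fun x : Plane => x i) :=
  (EuclideanSpace.proj (𝕜 := ℝ) (ι := Fin 2) i).contDiff

theorem contDiff_gaussian (a : ℝ) (z : Plane) : ContDiff ℝ ∞ (gaussian a z) := by
  have h0 := contDiff_coord 0
  have h1 := contDiff_coord 1
  unfold gaussian
  fun_prop

theorem pd_gaussian (a : ℝ) (z : Plane) (i : Fin 2) :
    pd i (gaussian a z) = fun x => -2 * a * ((x i - z i) * gaussian a z x) := by
  funext x
  have hc : ∀ j, HasPD i (fun y : Plane => y j - z j) _ x := fun j =>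
    (HasPD.coord j).sub (HasPD.const (z j))
  have h : HasPD i (gaussian a z) _ x :=
    ((((hc 0).mul (hc 0)).add ((hc 1).mul (hc 1))).const_mul (-a)).exp
  rw [h.pd_eq ((contDiff_gaussian a z).differentiable (by simp) x), ← gaussian]
  fin_cases i <;> simp <;> ring

theorem pd_pd_gaussian (a : ℝ) (z : Plane) (i j : Fin 2) (x : Plane) :
    pd i (pd j (gaussian a z)) x =
      (4 * a ^ 2 * ((x i - z i) * (x j - z j)) - if i = j then 2 * a else 0) * gaussian a z x := by
  have hc : HasPD i (fun y : Plane => y j - z j) _ x := (HasPD.coord j).sub (HasPD.const (z j))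
  have h := (hc.mul (HasPD.of_contDiff
    ((contDiff_gaussian a z).of_le (by exact_mod_cast le_top)))).const_mul (-2 * a)
  have hd : DifferentiableAt ℝ (pd j (gaussian a z)) x :=
    (((contDiff_gaussian a z).pd (n := ⊤) (k := 1) le_top j).differentiable (by norm_num)) x
  rw [pd_gaussian] at hd ⊢
  rw [h.pd_eq hd, pd_gaussian]
  split_ifs <;> ring

/-- Away from its centre, a steep Gaussian is a Carleman weight. -/
theorem exists_carlemanWeight_gaussian (z : Plane) {r R a : ℝ} (ha : 0 < a)
    (har : 2 ≤ a * r ^ 2) (hr : 0 < r) (hR : 0 ≤ R) {S : Set Plane}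
    (hSR : S ⊆ Metric.closedBall 0 R) (hSr : ∀ x ∈ S, r ≤ ‖x - z‖) :
    ∃ (m : Plane → ℝ) (c C₀ : ℝ), ∀ C, C₀ ≤ C → CarlemanWeight (gaussian a z) m c C S := by
  let ρ : Plane → ℝ := fun x => (x 0 - z 0) * (x 0 - z 0) + (x 1 - z 1) * (x 1 - z 1)
  have hρ : ContDiff ℝ ∞ ρ := by
    have h0 := contDiff_coord 0
    have h1 := contDiff_coord 1
    fun_prop
  have hρr : ∀ x ∈ S, 2 ≤ a * ρ x := fun x hx => by
    have e : ρ x = ‖x - z‖ ^ 2 := by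
      rw [EuclideanSpace.real_norm_sq_eq, Fin.sum_univ_two]; simp [ρ, sq]
    have := hSr x hx
    rw [e]
    exact har.trans (by gcongr)
  -- Chosen so that Δφ - m = -8aφ. Tangential gradients need this below -4aφ; positivity along ∇φ
  -- needs it above -(8a²ρ - 4a)φ, which is at most -12aφ when aρ ≥ 2.
  let m : Plane → ℝ := fun x => (4 * a ^ 2 * ρ x + 4 * a) * gaussian a z x
  have hg := contDiff_gaussian a z
  have hm : ContDiff ℝ ∞ m := by fun_prop
  have hK : IsCompact (Metric.closedBall (0 : Plane) R) := isCompact_closedBall _ _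
  obtain ⟨y, -, hy⟩ := hK.exists_isMinOn ⟨0, by simpa using hR⟩ hg.continuous.continuousOn
  set g := gaussian a z y with hgdef
  have hg0 : 0 < g := gaussian_pos a z y
  have hgx : ∀ x ∈ S, g ≤ gaussian a z x := fun x hx => hy (hSR hx)
  have hb : ∀ f : Plane → ℝ, Continuous f → ∃ A, ∀ x ∈ S, |f x| ≤ A := fun f hf => by
    obtain ⟨A, hA⟩ := hK.exists_bound_of_continuousOn hf.continuousOn
    exact ⟨A, fun x hx => hA x (hSR hx)⟩
  have hpd : ∀ {f : Plane → ℝ}, ContDiff ℝ ∞ f → ∀ i, Continuous (pd i f) := fun {f} hf i =>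
    (hf.pd (n := ⊤) (k := 0) le_top i).continuous
  obtain ⟨A0, hA0⟩ := hb _ (hpd hg 0)
  obtain ⟨A1, hA1⟩ := hb _ (hpd hg 1)
  obtain ⟨A2, hA2⟩ := hb _ (hpd hm 0)
  obtain ⟨A3, hA3⟩ := hb _ (hpd hm 1)
  obtain ⟨A4, hA4⟩ := hb (fun x => -(8 * a) * gaussian a z x)
    (continuous_const.mul hg.continuous)
  have hf : ∀ x, pd 0 (pd 0 (gaussian a z)) x + pd 1 (pd 1 (gaussian a z)) x - m x
      = -(8 * a) * gaussian a z x := fun x => by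
    rw [pd_pd_gaussian, pd_pd_gaussian]
    simp [m, ρ]; ring
  -- The two lower bounds, evaluated at the minimum `g` of the Gaussian on the closed ball. `C` may
  -- be enlarged because it must later bound the potential too.
  refine ⟨m, min (4 * a * g) (32 * a ^ 2 * g ^ 3),
    max 0 (max (max A0 A1) (max (max A2 A3) A4)), fun C hC => ?_⟩
  simp only [max_le_iff] at hC
  obtain ⟨hC0, ⟨h0, h1⟩, ⟨h2, h3⟩, h4⟩ := hC
  refine ⟨hg, hm, by positivity, hC0, ?_, ?_, ?_, ?_, ?_⟩
  · intro x hx s t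
    rw [hf, pd_pd_gaussian, pd_pd_gaussian, pd_pd_gaussian]
    have e : 0 ≤ gaussian a z x * (8 * a ^ 2 * ((x 0 - z 0) * s + (x 1 - z 1) * t) ^ 2) :=
      mul_nonneg (gaussian_pos a z x).le (by positivity)
    calc min (4 * a * g) (32 * a ^ 2 * g ^ 3) * (s ^ 2 + t ^ 2)
        ≤ (4 * a * gaussian a z x) * (s ^ 2 + t ^ 2) := by
          refine mul_le_mul_of_nonneg_right ((min_le_left _ _).trans ?_) (by positivity)
          have := hgx x hx
          gcongr
      _ ≤ (4 * a * gaussian a z x) * (s ^ 2 + t ^ 2)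
          + gaussian a z x * (8 * a ^ 2 * ((x 0 - z 0) * s + (x 1 - z 1) * t) ^ 2) := by linarith
      _ = _ := by simp; ring
  · intro x hx
    rw [hf, pd_pd_gaussian, pd_pd_gaussian, pd_pd_gaussian, pd_gaussian, pd_gaussian]
    have hx2 := hρr x hx
    have hgp := gaussian_pos a z x
    calc min (4 * a * g) (32 * a ^ 2 * g ^ 3) ≤ 32 * a ^ 2 * g ^ 3 := min_le_right _ _
      _ ≤ 32 * a ^ 2 * gaussian a z x ^ 3 := by have := hgx x hx; gcongr
      -- The exact value is 16a²φ³·aρ(2aρ - 3), and aρ ≥ 2.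
      _ = gaussian a z x ^ 3 * (16 * a ^ 2) * 2 := by ring
      _ ≤ gaussian a z x ^ 3 * (16 * a ^ 2 * (2 * (a * ρ x) - 3)) * (a * ρ x) := by
          have : 1 ≤ 2 * (a * ρ x) - 3 := by linarith
          have h16 : 16 * a ^ 2 ≤ 16 * a ^ 2 * (2 * (a * ρ x) - 3) :=
            le_mul_of_one_le_right (by positivity) this
          gcongr
      _ = _ := by simp [ρ]; ring
  · intro x hx i
    fin_cases i
    exacts [(hA0 x hx).trans h0, (hA1 x hx).trans h1]
  · intro x hx i
    fin_cases i
    exacts [(hA2 x hx).trans h2, (hA3 x hx).trans h3]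
  · intro x hx
    rw [hf]
    exact (hA4 x hx).trans h4

/-! ### Approximation of the potential. -/

/-- A potential is approximated by `C¹` functions with errors controlled by its scaled modulus. -/
theorem exists_approximation {R₀ R₁ M κ : ℝ} (hR₀ : 0 < R₀) (hR : R₀ ≤ R₁) {V : Plane → ℝ}
    (hVmeas : AEMeasurable V (volume.restrict (Metric.ball (0 : Plane) R₁)))
    (hVM : ∀ x ∈ Metric.ball (0 : Plane) R₁, |V x| ≤ M) (hκ : 0 < κ) :
    ∃ K B h₁ : ℝ, 0 ≤ K ∧ 0 ≤ B ∧ 0 < h₁ ∧ ∀ h, 0 < h → h ≤ h₁ →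
      0 < scaledModulus R₀ R₁ V κ h ∧ scaledModulus R₀ R₁ V κ h ≤ K ∧
      h ^ (2 / 3 : ℝ) ≤ B * scaledModulus R₀ R₁ V κ h ∧
      ∃ Vt : Plane → ℝ, ContDiff ℝ 1 Vt ∧ ∀ x ∈ Metric.ball (0 : Plane) R₀,
        |V x - Vt x| ≤ scaledModulus R₀ R₁ V κ h ∧ |Vt x| ≤ K ∧
        ∀ i, |pd i Vt x| ≤ K * (scaledModulus R₀ R₁ V κ h / h ^ (2 / 3 : ℝ)) := by
  have h00 : (0 : Plane) ∈ Metric.ball (0 : Plane) R₀ := by simpa using hR₀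
  have hsub : Metric.ball (0 : Plane) R₀ ⊆ Metric.ball 0 R₁ := Metric.ball_subset_ball hR
  have hM : 0 ≤ M := (abs_nonneg _).trans (hVM 0 (hsub h00))
  by_cases hconst : ∃ c : ℝ, ∀ x ∈ Metric.ball (0 : Plane) R₀, V x = c
  · have hw : ∀ h, scaledModulus R₀ R₁ V κ h = κ * h ^ (2 / 3 : ℝ) := fun h => by
      rw [scaledModulus, modulus, if_pos hconst]
    obtain ⟨c, hc⟩ := hconst
    -- The convention ω_V(θ) = θ gives the lower bound on the modulus directly.
    refine ⟨κ + M, κ⁻¹, 1, by positivity, by positivity, one_pos, fun h hh h1 => ?_⟩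
    have hp : 0 < h ^ (2 / 3 : ℝ) := by positivity
    have hp1 : h ^ (2 / 3 : ℝ) ≤ 1 := Real.rpow_le_one hh.le h1 (by norm_num)
    rw [hw]
    refine ⟨by positivity, ?_, ?_, fun _ => c, contDiff_const, fun x hx => ⟨?_, ?_, fun i => ?_⟩⟩
    · nlinarith
    · rw [inv_mul_cancel_left₀ hκ.ne']
    · rw [hc x hx, sub_self, abs_zero]; positivity
    · rw [← hc x hx]; linarith [hVM x (hsub hx)]
    · have : pd i (fun _ : Plane => c) x = 0 := by simp [pd]
      rw [this, abs_zero]; positivity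
  · have hw : ∀ h, scaledModulus R₀ R₁ V κ h
        = localOscillation R₀ (zeroExtension R₁ V) (κ * h ^ (2 / 3 : ℝ)) := fun h => by
      rw [scaledModulus, modulus, if_neg hconst]
    set W := zeroExtension R₁ V with hW
    have hWV : ∀ x ∈ Metric.ball (0 : Plane) R₀, W x = V x := fun x hx =>
      Set.indicator_of_mem (hsub hx) V
    have hWM : ∀ x, |W x| ≤ M := fun x => by
      by_cases hx : x ∈ Metric.ball (0 : Plane) R₁
      · rw [hW, zeroExtension, Set.indicator_of_mem hx]; exact hVM x hx
      · rw [hW, zeroExtension, Set.indicator_of_notMem hx, abs_zero]; exact hM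
    have hWi : Integrable W := by
      rw [hW, zeroExtension, integrable_indicator_iff Metric.isOpen_ball.measurableSet]
      have : IsFiniteMeasure (volume.restrict (Metric.ball (0 : Plane) R₁)) :=
        isFiniteMeasure_restrict.2 measure_ball_lt_top.ne
      exact Integrable.of_bound hVmeas.aestronglyMeasurable M
        ((ae_restrict_iff' Metric.isOpen_ball.measurableSet).2 (.of_forall hVM))
    push Not at hconst
    obtain ⟨y, hy, hyV⟩ := hconst (V 0)
    have hd : 0 < |W y - W 0| := by
      rw [hWV y hy, hWV 0 h00]; exact abs_pos.2 (sub_ne_zero.2 hyV)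
    obtain ⟨K₀, hK₀, hmol⟩ := exists_mollification_bound
    -- The bound on `h` ensures `θ ≤ 1`; 3M arises from |Vt| ≤ |V| + w with w ≤ 2M.
    refine ⟨K₀ / κ + 3 * M, (‖y‖ + 2) / (|W y - W 0| * κ), (1 / κ) ^ (3 / 2 : ℝ), by positivity,
      by positivity, by positivity, fun h hh h1 => ?_⟩
    have hp : 0 < h ^ (2 / 3 : ℝ) := by positivity
    have hp1 : κ * h ^ (2 / 3 : ℝ) ≤ 1 := by
      have := Real.rpow_le_rpow hh.le h1 (by norm_num : (0 : ℝ) ≤ 2 / 3)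
      rw [← Real.rpow_mul (by positivity)] at this
      norm_num at this
      calc κ * h ^ (2 / 3 : ℝ) ≤ κ * κ⁻¹ := by gcongr
        _ = 1 := mul_inv_cancel₀ hκ.ne'
    set θ := κ * h ^ (2 / 3 : ℝ) with hθ
    have hθ0 : 0 < θ := by positivity
    rw [hw]
    have hlow := le_localOscillation_of_ne hWM hy hθ0 hp1
    have hup := localOscillation_le (R₀ := R₀) hWM θ
    set w := localOscillation R₀ W θ with hwdef
    have hw0 : 0 < w := by
      have h2 : 0 < (‖y‖ + 2) * w := (mul_pos hθ0 hd).trans_le hlow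
      exact pos_of_mul_pos_right h2 (by positivity)
    obtain ⟨Vt, hVt, hVt2⟩ := hmol W M hWi hWM θ hθ0
    have hKκ : 0 < K₀ / κ := by positivity
    refine ⟨hw0, by linarith, ?_, Vt, hVt, fun x hx => ?_⟩
    · rw [div_mul_eq_mul_div, le_div_iff₀ (by positivity)]
      calc _ = θ * |W y - W 0| := by rw [hθ]; ring
        _ ≤ _ := hlow
    · obtain ⟨e1, e2⟩ := hVt2 x w (fun t ht => abs_sub_le_localOscillation hWM hx ht)
      rw [← hWV x hx]
      refine ⟨e1, ?_, fun i => (e2 i).trans ?_⟩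
      · have := hWM x
        rw [abs_le] at *
        constructor <;> linarith
      · have : K₀ * (w / θ) = K₀ / κ * (w / h ^ (2 / 3 : ℝ)) := by rw [hθ]; field_simp
        rw [this]
        gcongr
        linarith

/-! ### Real and imaginary parts, decoupled because the operator is real. -/

section ComplexSplitting

variable {u : Plane → ℂ}

theorem gradSq_eq (hu : ContDiff ℝ ∞ u) (x : Plane) :
    gradSq u x = (pd 0 (fun y => (u y).re) x ^ 2 + pd 1 (fun y => (u y).re) x ^ 2)
      + (pd 0 (fun y => (u y).im) x ^ 2 + pd 1 (fun y => (u y).im) x ^ 2) := by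
  have hd := (hu.differentiable (by simp) x).hasFDerivAt
  have hre : ∀ i, pd i (fun y => (u y).re) x
      = (fderiv ℝ u x (EuclideanSpace.single i 1)).re := fun i => by
    have h : HasFDerivAt (fun y => (u y).re) (Complex.reCLM ∘L fderiv ℝ u x) x :=
      Complex.reCLM.hasFDerivAt.comp x hd
    rw [pd, h.fderiv]
    rfl
  have him : ∀ i, pd i (fun y => (u y).im) x
      = (fderiv ℝ u x (EuclideanSpace.single i 1)).im := fun i => by
    have h : HasFDerivAt (fun y => (u y).im) (Complex.imCLM ∘L fderiv ℝ u x) x :=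
      Complex.imCLM.hasFDerivAt.comp x hd
    rw [pd, h.fderiv]
    rfl
  rw [gradSq, Fin.sum_univ_two, hre, hre, him, him, Complex.sq_norm, Complex.sq_norm,
    Complex.normSq_apply, Complex.normSq_apply]
  ring

theorem norm_schrodinger_sq (hu : ContDiff ℝ ∞ u) (h : ℝ) (V : Plane → ℝ) (E : ℝ) (x : Plane) :
    ‖schrodinger h V E u x‖ ^ 2 = realSchrodinger h V E (fun y => (u y).re) x ^ 2
      + realSchrodinger h V E (fun y => (u y).im) x ^ 2 := by
  have hu2 : ContDiff ℝ 2 u := contDiff_infty.1 hu 2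
  have hre : ContDiff ℝ 2 (fun y => (u y).re) := Complex.reCLM.contDiff.comp hu2
  have him : ContDiff ℝ 2 (fun y => (u y).im) := Complex.imCLM.contDiff.comp hu2
  have e1 : Laplacian.laplacian (fun y => (u y).re) x = (Laplacian.laplacian u x).re :=
    hu2.contDiffAt.laplacian_CLM_comp_left (l := Complex.reCLM)
  have e2 : Laplacian.laplacian (fun y => (u y).im) x = (Laplacian.laplacian u x).im :=
    hu2.contDiffAt.laplacian_CLM_comp_left (l := Complex.imCLM)
  rw [laplacian_eq_pd hre] at e1
  rw [laplacian_eq_pd him] at e2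
  rw [realSchrodinger, realSchrodinger, e1, e2, schrodinger, Complex.sq_norm,
    Complex.normSq_apply, ← Complex.ofReal_pow, ← Complex.ofReal_neg, ← Complex.ofReal_sub]
  simp only [Complex.add_re, Complex.add_im, Complex.re_ofReal_mul, Complex.im_ofReal_mul]
  ring

end ComplexSplitting

/-! ### Integration of the pointwise estimate. -/

/-- On expanding the square, `V` occurs only as a bounded measurable factor of continuous compactly
supported functions. -/
theorem integrableOn_mul_realSchrodinger_sq {S : Set Plane} {V g u : Plane → ℝ} {M : ℝ}
    (hS : MeasurableSet S) (hVmeas : AEMeasurable V (volume.restrict S))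
    (hVM : ∀ x ∈ S, |V x| ≤ M) (hg : Continuous g)
    (hu : ContDiff ℝ ∞ u) (huc : HasCompactSupport u) (h E : ℝ) :
    IntegrableOn (fun x => g x * realSchrodinger h V E u x ^ 2) S := by
  have c2 : ∀ i, Continuous (pd i (pd i u)) := fun i =>
    ((hu.pd (n := ⊤) (k := 1) le_top i).pd (n := 1) (k := 0) (by simp) i).continuous
  have hu0 := hu.continuous
  have c20 := c2 0
  have c21 := c2 1
  let A : Plane → ℝ := fun x => -h ^ 2 * (pd 0 (pd 0 u) x + pd 1 (pd 1 u) x) - E * u x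
  have hAc : HasCompactSupport A := by
    refine huc.of_isClosed_subset (isClosed_tsupport _) (closure_minimal (fun x hx => ?_)
      (isClosed_tsupport u))
    by_contra hn
    have z : ∀ i, pd i (pd i u) x = 0 := fun i =>
      pd_eq_zero_of_notMem_tsupport (fun h' => hn (tsupport_pd_subset u i h')) i
    exact hx (by simp [A, z, image_eq_zero_of_notMem_tsupport hn])
  have hA : Continuous A := by fun_prop
  have hVs : AEStronglyMeasurable V (volume.restrict S) := hVmeas.aestronglyMeasurable
  have hVb : ∀ᵐ x ∂volume.restrict S, ‖V x‖ ≤ M := (ae_restrict_iff' hS).2 (.of_forall hVM)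
  have i1 : IntegrableOn (fun x => g x * A x * A x) S :=
    ((hg.mul hA).mul hA).integrable_of_hasCompactSupport hAc.mul_left |>.integrableOn
  have i2 : IntegrableOn (fun x => g x * A x * u x) S :=
    ((hg.mul hA).mul hu0).integrable_of_hasCompactSupport huc.mul_left |>.integrableOn
  have i3 : IntegrableOn (fun x => g x * u x * u x) S :=
    ((hg.mul hu0).mul hu0).integrable_of_hasCompactSupport huc.mul_left |>.integrableOn
  have j2 := Integrable.bdd_mul (c := M) i2 hVs hVb
  have j3 := Integrable.bdd_mul (c := M) (Integrable.bdd_mul (c := M) i3 hVs hVb) hVs hVb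
  refine ((i1.add (j2.const_mul 2)).add j3).congr (.of_forall fun x => ?_)
  simp only [Pi.add_apply, realSchrodinger, A]
  ring

theorem integrable_mul_sq_add_grad_sq {g f : Plane → ℝ} {h : ℝ} (hg : Continuous g)
    (hf : ContDiff ℝ ∞ f) (hfc : HasCompactSupport f) :
    Integrable (fun x => g x * (f x ^ 2 + h ^ 2 * (pd 0 f x ^ 2 + pd 1 f x ^ 2))) := by
  have h0 := (hf.pd (n := ⊤) (k := 0) le_top 0).continuous
  have h1 := (hf.pd (n := ⊤) (k := 0) le_top 1).continuous
  have h2 := hf.continuous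
  refine Continuous.integrable_of_hasCompactSupport (by fun_prop)
    (hfc.of_isClosed_subset (isClosed_tsupport _) (closure_minimal (fun x hx => ?_)
      (isClosed_tsupport f)))
  by_contra hn
  exact hx (by simp [pd_eq_zero_of_notMem_tsupport hn, image_eq_zero_of_notMem_tsupport hn])

theorem setIntegral_le_of_density {G F D : Plane → ℝ} {S : Set Plane} {e A : ℝ} (he : 0 < e)
    (hG : IntegrableOn G S) (hF : IntegrableOn F S) (hD : IntegrableOn D S)
    (hD0 : ∫ x in S, D x = 0) (hle : ∀ x, e * G x ≤ A * (3 * F x - D x)) :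
    ∫ x in S, G x ≤ 3 * A / e * ∫ x in S, F x := by
  have h := integral_mono (hG.const_mul e) (((hF.const_mul 3).sub hD).const_mul A) hle
  simp only [Pi.sub_apply] at h
  rw [integral_const_mul, integral_const_mul, integral_sub (hF.const_mul 3) hD,
    integral_const_mul, hD0] at h
  rw [div_mul_eq_mul_div, le_div_iff₀ he]
  linarith

set_option maxHeartbeats 1000000 in
/-- The Carleman estimate for a dilate of a given Carleman weight. -/
theorem exists_carleman_estimate {R₀ R₁ M κ : ℝ} (hR₀ : 0 < R₀) (hR : R₀ ≤ R₁) {V : Plane → ℝ}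
    (hVmeas : AEMeasurable V (volume.restrict (Metric.ball (0 : Plane) R₁)))
    (hVM : ∀ x ∈ Metric.ball (0 : Plane) R₁, |V x| ≤ M) (hκ : 0 < κ) {I : Set ℝ}
    (hI : IsCompact I) {φ m : Plane → ℝ} {c C₀ : ℝ} {S : Set Plane}
    (hφ : ∀ C, C₀ ≤ C → CarlemanWeight φ m c C S) (hS : S ⊆ Metric.ball 0 R₀) :
    ∃ l h₀ C : ℝ, 0 < l ∧ 0 < h₀ ∧ 0 < C ∧ ∀ E ∈ I, ∀ h : ℝ, 0 < h → h ≤ h₀ →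
      ∀ u : Plane → ℂ, IsTestFunctionOn S u →
        ∫ x in Metric.ball (0 : Plane) R₀,
            weight (fun x => l * φ x) (scaledModulus R₀ R₁ V κ h) h x *
              (‖u x‖ ^ 2 + h ^ 2 * gradSq u x)
          ≤ C / ((scaledModulus R₀ R₁ V κ h) ^ (1 / 2 : ℝ) * h ^ (2 / 3 : ℝ)) *
            ∫ x in Metric.ball (0 : Plane) R₀,
              weight (fun x => l * φ x) (scaledModulus R₀ R₁ V κ h) h x *
                ‖schrodinger h V E u x‖ ^ 2 := by
  obtain ⟨K, B, h₁, hK, hB, hh₁, happ⟩ := exists_approximation hR₀ hR hVmeas hVM hκ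
  obtain ⟨N, hN⟩ := hI.isBounded.exists_norm_le
  -- K + N bounds |Vt - E| uniformly for E in I.
  set C := max C₀ (K + N) with hCdef
  have hCφ := hφ C (le_max_left _ _)
  have hC0 := hCφ.nonneg
  have hc := hCφ.pos
  -- The threshold that l²c must reach in `carleman_pointwise`, with K + 1 for K; `l` is thus fixed
  -- before `h`.
  set T := 2 * C * (K + 1) + C ^ 2 * B + 3 * (K + 1) + 3 with hT
  have hT0 : 0 ≤ T := by positivity
  set l := 1 + T / c with hl
  have hl1 : 1 ≤ l := by rw [hl]; linarith [div_nonneg hT0 hc.le]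
  have hlT : T ≤ l ^ 2 * c := by
    calc T ≤ c + T := by linarith
      _ = l * c := by rw [hl]; field_simp
      _ ≤ l ^ 2 * c := mul_le_mul_of_nonneg_right (by nlinarith) hc.le
  -- Sum of the coefficients of `h` in the three smallness conditions.
  set X := 2 * C / c + C * B + 3 * (l ^ 2 * C ^ 2) * (1 + B) with hX
  have hX0 : 0 ≤ X := by positivity
  set A := 2 / c + B + 4 * C ^ 2 * l ^ 2 with hA
  have hA0 : 0 < A := by positivity
  refine ⟨l, min h₁ (1 / (X + 1)), 3 * A, by linarith, by positivity, by positivity, ?_⟩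
  intro E hE h hh hh0 u ⟨hu, huc, huS⟩
  obtain ⟨hw0, hwK, hBw, Vt, hVt, hVtx⟩ := happ h hh (hh0.trans (min_le_left _ _))
  have hhX : h * X ≤ 1 := by
    have := hh0.trans (min_le_right _ _)
    rw [le_div_iff₀ (by positivity)] at this
    linarith
  set w := scaledModulus R₀ R₁ V κ h with hw
  clear_value w
  -- In terms of w^{1/2} and h^{1/3} all real powers become integral ones.
  set a := w ^ (1 / 2 : ℝ) with ha
  set t := h ^ (1 / 3 : ℝ) with ht
  have ha0 : 0 < a := by positivity
  have ht0 : 0 < t := by positivity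
  have ha2 : w = a ^ 2 := by
    rw [ha, ← Real.rpow_natCast, ← Real.rpow_mul hw0.le]; norm_num
  have ht3 : h = t ^ 3 := by
    rw [ht, ← Real.rpow_natCast, ← Real.rpow_mul hh.le]; norm_num
  have ht2 : h ^ (2 / 3 : ℝ) = t ^ 2 := by
    rw [ht, ← Real.rpow_natCast, ← Real.rpow_mul hh.le]; norm_num
  have ht4 : h ^ (4 / 3 : ℝ) = t ^ 4 := by
    rw [ht, ← Real.rpow_natCast, ← Real.rpow_mul hh.le]; norm_num
  set τ := a / t with hτ
  have hτ0 : 0 < τ := by positivity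
  have hτ2 : τ ^ 2 = w / h ^ (2 / 3 : ℝ) := by rw [hτ, div_pow, ht2, ha2]
  have hhτ : h * τ = a * h ^ (2 / 3 : ℝ) := by rw [ht2, ht3, hτ]; field_simp
  have hBτ : 1 ≤ B * τ ^ 2 := by
    rw [hτ2, mul_div_assoc', le_div_iff₀ (by positivity), one_mul]
    exact hBw
  have ha1 : a ≤ K + 1 := by nlinarith [sq_nonneg (a - 1)]
  have hwτ : w ^ 2 ≤ (K + 1) * (h * τ ^ 3) := by
    have e : h * τ ^ 3 = a ^ 3 := by rw [ht3, hτ]; field_simp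
    calc w ^ 2 = a * a ^ 3 := by rw [ha2]; ring
      _ ≤ (K + 1) * a ^ 3 := by gcongr
      _ = _ := by rw [e]
  have hX1 : 2 * C / c ≤ X := by
    have : 0 ≤ C * B + 3 * (l ^ 2 * C ^ 2) * (1 + B) := by positivity
    rw [hX]; linarith
  have hX2 : C * B ≤ X := by
    have : 0 ≤ 2 * C / c + 3 * (l ^ 2 * C ^ 2) * (1 + B) := by positivity
    rw [hX]; linarith
  have hX3 : 3 * (l ^ 2 * C ^ 2) * (1 + B) ≤ X := by
    have : 0 ≤ 2 * C / c + C * B := by positivity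
    rw [hX]; linarith
  have hsmall : ∀ {Y : ℝ}, Y ≤ X → h * Y ≤ 1 := fun {Y} hY =>
    (mul_le_mul_of_nonneg_left hY hh.le).trans hhX
  have hhC : 2 * (h * C) ≤ c := by
    have := hsmall hX1
    rw [mul_div_assoc', div_le_one hc] at this
    linarith
  have hhB : h * C * B ≤ 1 := by rw [mul_assoc]; exact hsmall hX2
  have hhl : 3 * (h * (l ^ 2 * C ^ 2)) * (1 + B) ≤ 1 := by
    have := hsmall hX3
    linarith
  have dens := fun {f : Plane → ℝ} (hf : ContDiff ℝ ∞ f) (hfc : HasCompactSupport f)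
    (hfS : tsupport f ⊆ S) => exists_carleman_density (E := E) (V := V) hCφ hf hfc hfS hh hτ0 hl1
      (by linarith : 0 ≤ K + 1) hB hVt
      (fun x hx => (abs_sub _ _).trans ((add_le_add (hVtx x (hS hx)).2.1 (hN E hE)).trans
        (le_max_right _ _)))
      (fun x hx i => by
        rw [hτ2]
        refine ((hVtx x (hS hx)).2.2 i).trans (mul_le_mul_of_nonneg_right ?_ (by positivity))
        linarith)
      (fun x hx => (hVtx x (hS hx)).1) hBτ hwτ hhC hhB hhl hlT
  have hre : ContDiff ℝ ∞ (fun y => (u y).re) := Complex.reCLM.contDiff.comp hu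
  have him : ContDiff ℝ ∞ (fun y => (u y).im) := Complex.imCLM.contDiff.comp hu
  have hrec : HasCompactSupport (fun y => (u y).re) := huc.comp_left Complex.zero_re
  have himc : HasCompactSupport (fun y => (u y).im) := huc.comp_left Complex.zero_im
  have hres : tsupport (fun y => (u y).re) ⊆ S :=
    (tsupport_comp_subset Complex.zero_re u).trans huS
  have hims : tsupport (fun y => (u y).im) ⊆ S :=
    (tsupport_comp_subset Complex.zero_im u).trans huS
  obtain ⟨D₁, hD₁i, hD₁0, hD₁s, hD₁⟩ := dens hre hrec hres
  obtain ⟨D₂, hD₂i, hD₂0, hD₂s, hD₂⟩ := dens him himc hims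
  have hwt : ∀ x, weight (fun x => l * φ x) w h x = Real.exp (τ / h * l * φ x) ^ 2 := fun x => by
    rw [weight, ← ha, ht4, ← Real.exp_nat_mul, hτ, ht3]
    congr 1
    push_cast
    field_simp
  simp_rw [hwt, gradSq_eq hu, norm_schrodinger_sq hu, Complex.sq_norm, Complex.normSq_apply]
  have hball : MeasurableSet (Metric.ball (0 : Plane) R₀) := Metric.isOpen_ball.measurableSet
  have hsub : Metric.ball (0 : Plane) R₀ ⊆ Metric.ball 0 R₁ := Metric.ball_subset_ball hR
  have hg : Continuous fun x => Real.exp (τ / h * l * φ x) ^ 2 := by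
    have := hCφ.contDiff.continuous
    fun_prop
  have iF := fun {f : Plane → ℝ} (hf : ContDiff ℝ ∞ f) (hfc : HasCompactSupport f) =>
    integrableOn_mul_realSchrodinger_sq hball
      (hVmeas.mono_measure (Measure.restrict_mono hsub le_rfl)) (fun x hx => hVM x (hsub hx))
      hg hf hfc h E
  have iF1 := iF hre hrec
  have iF2 := iF him himc
  -- `D` vanishes off the support, so its integral over the ball is the full one.
  have zeroD : ∀ {D f : Plane → ℝ}, tsupport f ⊆ S → (∀ x, x ∉ tsupport f → D x = 0) →
      ∫ x, D x = 0 → ∫ x in Metric.ball (0 : Plane) R₀, D x = 0 := fun {D f} hf hD h0 => by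
    rw [setIntegral_eq_integral_of_forall_compl_eq_zero, h0]
    exact fun x hx => hD x fun h' => hx (hS (hf h'))
  have iG1 := (integrable_mul_sq_add_grad_sq (h := h) hg hre hrec).integrableOn
    (s := Metric.ball (0 : Plane) R₀)
  have iG2 := (integrable_mul_sq_add_grad_sq (h := h) hg him himc).integrableOn
    (s := Metric.ball (0 : Plane) R₀)
  have hhτ0 : 0 < h * τ := mul_pos hh hτ0
  have m1 := setIntegral_le_of_density hhτ0 iG1 iF1 hD₁i.integrableOn (zeroD hres hD₁s hD₁0) hD₁
  have m2 := setIntegral_le_of_density hhτ0 iG2 iF2 hD₂i.integrableOn (zeroD hims hD₂s hD₂0) hD₂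
  rw [← hhτ]
  have e1 := integral_add iG1 iG2
  have e2 := integral_add iF1 iF2
  calc _ = _ := integral_congr_ae (.of_forall fun x => by ring)
    _ = _ := e1
    _ ≤ _ := add_le_add m1 m2
    _ = 3 * A / (h * τ) * _ := by rw [← mul_add, ← e2]
    _ = _ := by congr 1; exact integral_congr_ae (.of_forall fun x => by ring)

/-! ### The two estimates. -/

theorem mainTheorem3
    (R R₀ R₁ : ℝ) (hR : 0 < R) (hRR₀ : R < R₀) (hR₀R₁ : R₀ ≤ R₁)
    (V : Plane → ℝ)
    (hVmeas : AEMeasurable V (volume.restrict (Metric.ball (0 : Plane) R₁)))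
    (hVbdd : ∃ M : ℝ, ∀ x ∈ Metric.ball (0 : Plane) R₁, |V x| ≤ M)
    (I : Set ℝ) (hI : IsCompact I) :
    (∃ κ₀ : ℝ, 0 < κ₀ ∧ ∀ κ : ℝ, 0 < κ → κ ≤ κ₀ →
      ∃ (φ : Plane → ℝ) (h₀ C : ℝ),
        ContDiff ℝ ∞ φ ∧ (∀ x, 0 < φ x) ∧ 0 < h₀ ∧ 0 < C ∧
        ∀ E ∈ I, ∀ h : ℝ, 0 < h → h ≤ h₀ →
          ∀ u : Plane → ℂ, IsTestFunctionOn (Metric.ball (0 : Plane) R₀) u →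
            ∫ x in Metric.ball (0 : Plane) R₀,
                weight φ (scaledModulus R₀ R₁ V κ h) h x *
                  (‖u x‖ ^ 2 + h ^ 2 * gradSq u x)
              ≤ C / ((scaledModulus R₀ R₁ V κ h) ^ (1 / 2 : ℝ) * h ^ (2 / 3 : ℝ)) *
                ∫ x in Metric.ball (0 : Plane) R₀,
                  weight φ (scaledModulus R₀ R₁ V κ h) h x * ‖schrodinger h V E u x‖ ^ 2) ∧
    (∃ κ₀ : ℝ, 0 < κ₀ ∧ ∀ κ : ℝ, 0 < κ → κ ≤ κ₀ →
      ∃ (φ : Plane → ℝ) (h₀ C : ℝ),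
        ContDiff ℝ ∞ φ ∧ (∀ x, 0 < φ x) ∧ RadiallyDecreasing φ ∧ 0 < h₀ ∧ 0 < C ∧
        ∀ E ∈ I, ∀ h : ℝ, 0 < h → h ≤ h₀ →
          ∀ u : Plane → ℂ,
            IsTestFunctionOn (Metric.ball (0 : Plane) R₀ \ Metric.ball (0 : Plane) (R / 2)) u →
            ∫ x in Metric.ball (0 : Plane) R₀,
                weight φ (scaledModulus R₀ R₁ V κ h) h x *
                  (‖u x‖ ^ 2 + h ^ 2 * gradSq u x)
              ≤ C / ((scaledModulus R₀ R₁ V κ h) ^ (1 / 2 : ℝ) * h ^ (2 / 3 : ℝ)) *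
                ∫ x in Metric.ball (0 : Plane) R₀,
                  weight φ (scaledModulus R₀ R₁ V κ h) h x * ‖schrodinger h V E u x‖ ^ 2) := by
  obtain ⟨M, hM⟩ := hVbdd
  have hR₀ : 0 < R₀ := hR.trans hRR₀
  -- The threshold 1 is arbitrary: `κ` only influences the constants.
  refine ⟨⟨1, one_pos, fun κ hκ _ => ?_⟩, ⟨1, one_pos, fun κ hκ _ => ?_⟩⟩
  -- A centre at distance 2R₀ from the origin keeps the critical point at distance at least R₀ from
  -- the ball; the rate gives ar² = 2.
  · obtain ⟨m, c, C₀, hφ⟩ := exists_carlemanWeight_gaussian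
      (EuclideanSpace.single 0 (2 * R₀)) (a := 2 / R₀ ^ 2) (r := R₀) (R := R₀)
      (S := Metric.ball 0 R₀) (by positivity) (by field_simp; rfl) hR₀ hR₀.le
      Metric.ball_subset_closedBall (fun x hx => by
        rw [mem_ball_zero_iff] at hx
        have h1 := norm_sub_norm_le (EuclideanSpace.single (0 : Fin 2) (2 * R₀)) x
        rw [PiLp.norm_single, Real.norm_of_nonneg (by linarith), norm_sub_rev] at h1
        linarith)
    obtain ⟨l, h₀, C, hl, hh₀, hC, hest⟩ :=
      exists_carleman_estimate hR₀ hR₀R₁ hVmeas hM hκ hI hφ subset_rfl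
    exact ⟨_, h₀, C, contDiff_const.mul (contDiff_gaussian _ _),
      fun x => mul_pos hl (gaussian_pos _ _ x), hh₀, hC, hest⟩
  -- Centred at 0 the weight is radial, and its critical point lies in the removed disc.
  · obtain ⟨m, c, C₀, hφ⟩ := exists_carlemanWeight_gaussian
      0 (a := 2 / (R / 2) ^ 2) (r := R / 2) (R := R₀)
      (S := Metric.ball 0 R₀ \ Metric.ball 0 (R / 2)) (by positivity) (by field_simp; rfl)
      (by positivity) hR₀.le (Set.sdiff_subset.trans Metric.ball_subset_closedBall)
      (fun x hx => by simpa using hx.2)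
    obtain ⟨l, h₀, C, hl, hh₀, hC, hest⟩ :=
      exists_carleman_estimate hR₀ hR₀R₁ hVmeas hM hκ hI hφ Set.sdiff_subset
    refine ⟨_, h₀, C, contDiff_const.mul (contDiff_gaussian _ _),
      fun x => mul_pos hl (gaussian_pos _ _ x),
      ⟨fun r => l * Real.exp (-(2 / (R / 2) ^ 2) * r ^ 2), ?_, fun x => ?_⟩, hh₀, hC, hest⟩
    · intro r hr s _ hrs
      have h0 : (0 : ℝ) ≤ r := hr
      have h1 : r ^ 2 < s ^ 2 := by gcongr
      have h2 : (0 : ℝ) < 2 / (R / 2) ^ 2 := by positivity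
      refine mul_lt_mul_of_pos_left (Real.exp_lt_exp.2 ?_) hl
      rw [neg_mul, neg_mul, neg_lt_neg_iff]
      exact mul_lt_mul_of_pos_left h1 h2
    · simp only [gaussian_eq, sub_zero]
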